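/- Let $n\ge 2$ be an integer and $d=\binom n2$. For $y\in\{-1,1\}^n$ let $Z(y)=(y_iy_j)_{1\le i<j\le n}\in\{-1,1\}^d$, and let $M=\{Z(y): y\in\{-1,1\}^n\}$. Let $(X_t)_{t\ge 0}$ be the random walk on $\mathbb Z^d$ whose increments are independent and uniformly distributed on $M$, and let $P_n^t(x,y)=\mathbb P(X_t=y\mid X_0=x)$ be its $t$-step transition matrix. For an integer $t\ge 1$ and real $\delta$ put $$U(n,t,\delta)=\bigl[1+\tfrac19(n\delta)^6\bigr]^{t/2}\bigl[1+\tfrac1{12}(n\delta)^4\bigr]^{t}\bigl[1-e^{-t\delta^2}\bigr]^{d/2},$$ $$L(n,t,\delta)=\bigl[1+\tfrac49t^2(n\delta)^6\bigr]^{-1/2}\bigl[1-\tfrac1{12}(n\delta)^4\bigr]^{t}\bigl[1-e^{-\frac12t\delta^2}\bigr]^{d/2}.$$ Theorem. Let $t$ be a positive integer and let $\delta$ be a real number with $n\delta\in(0,1)$. Then $$P_n^{4t}(0,0)\le 2^{2d-n+1}(8\pi t)^{-d/2}\,U(n,4t,\delta)+e^{-\frac{11}{6}t\delta^2}.$$ Moreover,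 if $4t(n\delta)^3<1$, then $$P_n^{4t}(0,0)\ge 2^{2d-n+1}(8\pi t)^{-d/2}\,L(n,4t,\delta)-e^{-\frac{11}{6}t\delta^2}.$$ -/

import Mathlib

namespace PartialHadamard

/-- The coordinates `{i, j}`, `1 ≤ i < j ≤ n`, of the walk; there are `n.choose 2` of them. -/
abbrev Edge (n : ℕ) : Type := {p : Fin n × Fin n // p.1 < p.2}

/-- The map `y ↦ (y₁y₂, y₁y₃, …, yₙ₋₁yₙ)` from sign vectors to the lattice of the walk
(`ℤˣ = {-1, 1}`). -/
def Z {n : ℕ} (y : Fin n → ℤˣ) : Edge n → ℤ :=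
  fun e => (y e.1.1 : ℤ) * (y e.1.2 : ℤ)

/-- The set `M = {Z y : y ∈ {-1, 1}ⁿ}` of increments. -/
def M (n : ℕ) : Finset (Edge n → ℤ) :=
  Finset.univ.image (Z (n := n))

theorem M_nonempty (n : ℕ) : (M n).Nonempty :=
  Finset.univ_nonempty.image _

/-- The law of `X_t` for the random walk `(X_t)` started at `x`, whose increments are
independent and uniformly distributed on the set `M n`. -/
noncomputable def walkLaw (n : ℕ) (x : Edge n → ℤ) : ℕ → PMF (Edge n → ℤ)
  | 0 => PMF.pure x
  | t + 1 => (walkLaw n x t).bind fun z =>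
      (PMF.uniformOfFinset (M n) (M_nonempty n)).map fun m => z + m

/-- The `t`-step transition matrix `P_n^t(x, y) = ℙ(X_t = y ∣ X_0 = x)`. -/
noncomputable def P (n t : ℕ) (x y : Edge n → ℤ) : ℝ :=
  (walkLaw n x t y).toReal

/-- The factor `U(n, t, δ)` of the upper bound, with `d = n.choose 2`. -/
noncomputable def U (n t : ℕ) (δ : ℝ) : ℝ :=
  (1 + 1 / 9 * ((n : ℝ) * δ) ^ 6) ^ ((t : ℝ) / 2) *
    (1 + 1 / 12 * ((n : ℝ) * δ) ^ 4) ^ t *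
    (1 - Real.exp (-((t : ℝ) * δ ^ 2))) ^ ((n.choose 2 : ℝ) / 2)

/-- The factor `L(n, t, δ)` of the lower bound, with `d = n.choose 2`. -/
noncomputable def L (n t : ℕ) (δ : ℝ) : ℝ :=
  (1 + 4 / 9 * (t : ℝ) ^ 2 * ((n : ℝ) * δ) ^ 6) ^ (-(1 / 2) : ℝ) *
    (1 - 1 / 12 * ((n : ℝ) * δ) ^ 4) ^ t *
    (1 - Real.exp (-(1 / 2 * (t : ℝ) * δ ^ 2))) ^ ((n.choose 2 : ℝ) / 2)

end PartialHadamard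

/-! Write φ(λ) = E exp(i λ·Z(y)) for uniform signs y. Fourier inversion (`P_fourier`) expresses the
return probability as the mean of φ^{4t} over the torus, cut into 4^d cubes of side π/2 centred at
the points (π/2)m. Since e^{iπs/2} = is for s = ±1, on the cube of m the function φ is a power of i
times a mean twisted by a sign character χ_m (`charFn_quarterShift_add`). If χ_m = 1, then φ^{4t}
repeats its values on the central cube; orthogonality of characters gives 2^{2d-n+1} such m
(`card_edgeChar_eq_one`). Pairing y with its flip at one coordinate (`normSq_twistedMean_le`) shows
|φ|² ≤ 1/2 on the other cubes, and |φ|² ≤ 1 - (11/12)δ² on the part of the central cube outside [-δ,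
δ]^d. These regions make up the exponential error.

There remains the integral of φ^{4t} over [-δ, δ]^d. Here λ·Z(y) is a quadratic form Q in random
signs with E Q = 0, E Q² = r = |λ|² and E Q⁴ ≤ 15r² (`signMean_quadForm_pow_four_le`). Taylor
expansion then gives Re φ = 1 - r/2 + O(r²) and Im φ = O(r^{3/2}), which places φ^T between
Gaussians (`norm_charFn_pow_le`, `re_charFn_pow_ge`). The Gaussian integral over the cube is a power
of a one-dimensional one, whose square is compared with integrals over discs. -/

namespace PartialHadamard

/-! ### Moments of linear and quadratic forms in random signs -/

/-- The expectation of `f` under the uniform distribution on sign vectors. -/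
noncomputable def signMean {n : ℕ} (f : (Fin n → ℤˣ) → ℝ) : ℝ := (∑ y, f y) / 2 ^ n

theorem sum_units_int {E : Type*} [AddCommMonoid E] (f : ℤˣ → E) : ∑ s, f s = f 1 + f (-1) := by
  rw [show (Finset.univ : Finset ℤˣ) = {1, -1} from rfl, Finset.sum_pair (by decide)]

theorem signMean_zero_dim (f : (Fin 0 → ℤˣ) → ℝ) : signMean f = f default := by
  simp [signMean, Unique.eq_default]

theorem signMean_succ {n : ℕ} (f : (Fin (n + 1) → ℤˣ) → ℝ) :
    signMean f = signMean fun y : Fin n → ℤˣ => (f (Fin.cons 1 y) + f (Fin.cons (-1) y)) / 2 := by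
  have h : ∑ y, f y = ∑ p : ℤˣ × (Fin n → ℤˣ), f (Fin.cons p.1 p.2) :=
    (Fintype.sum_equiv (Fin.consEquiv fun _ : Fin (n + 1) => ℤˣ) _ _ fun p => rfl).symm
  unfold signMean
  rw [h, Fintype.sum_prod_type, sum_units_int, ← Finset.sum_add_distrib, ← Finset.sum_div, pow_succ]
  field_simp

section
variable {n : ℕ}

theorem signMean_add (f g : (Fin n → ℤˣ) → ℝ) :
    signMean (fun y => f y + g y) = signMean f + signMean g := by
  simp [signMean, Finset.sum_add_distrib, add_div]

theorem signMean_sub (f g : (Fin n → ℤˣ) → ℝ) :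
    signMean (fun y => f y - g y) = signMean f - signMean g := by
  simp [signMean, Finset.sum_sub_distrib, sub_div]

theorem signMean_const_mul (c : ℝ) (f : (Fin n → ℤˣ) → ℝ) :
    signMean (fun y => c * f y) = c * signMean f := by
  simp [signMean, ← Finset.mul_sum, mul_div_assoc]

theorem signMean_const (c : ℝ) : signMean (fun _ : Fin n → ℤˣ => c) = c := by
  simp [signMean]

theorem signMean_mono {f g : (Fin n → ℤˣ) → ℝ} (h : ∀ y, f y ≤ g y) :
    signMean f ≤ signMean g := by
  unfold signMean
  gcongr with y _
  exact h y

theorem abs_signMean_le (f : (Fin n → ℤˣ) → ℝ) : |signMean f| ≤ signMean fun y => |f y| := by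
  unfold signMean
  rw [abs_div, abs_of_pos (by positivity : (0 : ℝ) < 2 ^ n)]
  gcongr
  exact Finset.abs_sum_le_sum_abs _ _

theorem signMean_mul_sq_le (f g : (Fin n → ℤˣ) → ℝ) :
    signMean (fun y => f y * g y) ^ 2 ≤
      signMean (fun y => f y ^ 2) * signMean (fun y => g y ^ 2) := by
  unfold signMean
  rw [div_pow, div_mul_div_comm, ← sq]
  gcongr
  exact Finset.sum_mul_sq_le_sq_mul_sq _ _ _

/-- The linear form `∑ aᵢ yᵢ` in a sign vector. -/
noncomputable def linForm (a : Fin n → ℝ) (y : Fin n → ℤˣ) : ℝ := ∑ i, a i * ((y i : ℤ) : ℝ)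

/-- The quadratic form `∑_{i<j} aᵢⱼ yᵢ yⱼ` in a sign vector. -/
noncomputable def quadForm (A : Fin n → Fin n → ℝ) (y : Fin n → ℤˣ) : ℝ :=
  ∑ i, ∑ j, if i < j then A i j * (((y i : ℤ) : ℝ) * ((y j : ℤ) : ℝ)) else 0

/-- The sum of squares of the coefficients of `quadForm A`. -/
noncomputable def upperSq (A : Fin n → Fin n → ℝ) : ℝ :=
  ∑ i, ∑ j, if i < j then A i j ^ 2 else 0

theorem upperSq_nonneg (A : Fin n → Fin n → ℝ) : 0 ≤ upperSq A := by
  unfold upperSq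
  refine Finset.sum_nonneg fun i _ => Finset.sum_nonneg fun j _ => ?_
  split_ifs <;> positivity

end

section
variable {n : ℕ}

theorem linForm_cons (a : Fin (n + 1) → ℝ) (s : ℤˣ) (y : Fin n → ℤˣ) :
    linForm a (Fin.cons s y : Fin (n + 1) → ℤˣ) =
      a 0 * ((s : ℤ) : ℝ) + linForm (fun i => a i.succ) y := by
  simp [linForm, Fin.sum_univ_succ]

theorem quadForm_cons (A : Fin (n + 1) → Fin (n + 1) → ℝ) (s : ℤˣ) (y : Fin n → ℤˣ) :
    quadForm A (Fin.cons s y : Fin (n + 1) → ℤˣ) =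
      ((s : ℤ) : ℝ) * linForm (fun j => A 0 j.succ) y +
        quadForm (fun i j => A i.succ j.succ) y := by
  simp only [quadForm, linForm, Fin.sum_univ_succ, Fin.cons_zero, Fin.cons_succ,
    Fin.succ_pos, Fin.not_lt_zero, Fin.succ_lt_succ_iff, if_true, if_false, zero_add,
    Finset.mul_sum]
  congr 1
  exact Finset.sum_congr rfl fun j _ => by ring

theorem upperSq_succ (A : Fin (n + 1) → Fin (n + 1) → ℝ) :
    upperSq A = ∑ j : Fin n, A 0 j.succ ^ 2 + upperSq (fun i j : Fin n => A i.succ j.succ) := by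
  simp only [upperSq, Fin.sum_univ_succ,
    Fin.succ_pos, Fin.not_lt_zero, Fin.succ_lt_succ_iff, if_true, if_false, zero_add]

end

theorem signMean_linForm_mul {n : ℕ} (a b : Fin n → ℝ) :
    signMean (fun y => linForm a y * linForm b y) = ∑ i, a i * b i := by
  induction n with
  | zero => simp [signMean_zero_dim, linForm]
  | succ n ih =>
    rw [signMean_succ, Fin.sum_univ_succ, ← ih, ← signMean_const (n := n) (a 0 * b 0),
      ← signMean_add]
    congr 1; ext y
    simp only [linForm_cons, Units.val_one, Units.val_neg, Int.cast_one, Int.cast_neg]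
    ring

theorem signMean_linForm_sq {n : ℕ} (a : Fin n → ℝ) :
    signMean (fun y => linForm a y ^ 2) = ∑ i, a i ^ 2 := by
  simpa only [sq] using signMean_linForm_mul a a

/-- The right side is the value for Gaussian variables; signs fall short of it by 2aᵢ²bᵢ² for each
coordinate. -/
theorem signMean_linForm_sq_mul_sq_le {n : ℕ} (a b : Fin n → ℝ) :
    signMean (fun y => linForm a y ^ 2 * linForm b y ^ 2) ≤
      (∑ i, a i ^ 2) * (∑ i, b i ^ 2) + 2 * (∑ i, a i * b i) ^ 2 := by
  induction n with
  | zero => simp [signMean_zero_dim, linForm]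
  | succ n ih =>
    have h := ih (fun i => a i.succ) (fun i => b i.succ)
    have e : signMean (fun y => linForm a y ^ 2 * linForm b y ^ 2) =
        signMean (fun y => linForm (fun i => a i.succ) y ^ 2 * linForm (fun i => b i.succ) y ^ 2)
        + a 0 ^ 2 * b 0 ^ 2 + 4 * (a 0 * b 0) * (∑ i : Fin n, a i.succ * b i.succ)
        + a 0 ^ 2 * (∑ i : Fin n, b i.succ ^ 2) + b 0 ^ 2 * (∑ i : Fin n, a i.succ ^ 2) := by
      rw [← signMean_linForm_mul, ← signMean_linForm_sq, ← signMean_linForm_sq, signMean_succ,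
        ← signMean_const_mul, ← signMean_const_mul, ← signMean_const_mul,
        ← signMean_const (n := n) (a 0 ^ 2 * b 0 ^ 2), ← signMean_add, ← signMean_add,
        ← signMean_add, ← signMean_add]
      congr 1; ext y
      simp only [linForm_cons, Units.val_one, Units.val_neg, Int.cast_one, Int.cast_neg]
      ring
    rw [e, Fin.sum_univ_succ, Fin.sum_univ_succ, Fin.sum_univ_succ]
    nlinarith [h, sq_nonneg (a 0 * b 0)]

theorem signMean_quadForm {n : ℕ} (A : Fin n → Fin n → ℝ) : signMean (quadForm A) = 0 := by
  induction n with
  | zero => simp [signMean_zero_dim, quadForm]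
  | succ n ih =>
    rw [signMean_succ, ← ih fun i j => A i.succ j.succ]
    congr 1; ext y
    simp only [quadForm_cons, Units.val_one, Units.val_neg, Int.cast_one, Int.cast_neg]
    ring

theorem signMean_quadForm_sq {n : ℕ} (A : Fin n → Fin n → ℝ) :
    signMean (fun y => quadForm A y ^ 2) = upperSq A := by
  induction n with
  | zero => simp [signMean_zero_dim, quadForm, upperSq]
  | succ n ih =>
    rw [signMean_succ, upperSq_succ, ← ih, ← signMean_linForm_sq, ← signMean_add]
    congr 1; ext y
    simp only [quadForm_cons, Units.val_one, Units.val_neg, Int.cast_one, Int.cast_neg]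
    ring

/-- As Q has mean zero, the product of linear forms may be centred before Cauchy–Schwarz; its
variance is at most |a|²|b|² + p² ≤ 2|a|²|b|². -/
theorem signMean_quadForm_mul_linForm_mul_linForm_sq_le {n : ℕ} (A : Fin n → Fin n → ℝ)
    (a b : Fin n → ℝ) :
    signMean (fun y => quadForm A y * (linForm a y * linForm b y)) ^ 2 ≤
      2 * upperSq A * ((∑ i, a i ^ 2) * (∑ i, b i ^ 2)) := by
  set p := ∑ i, a i * b i with hp
  have e1 : signMean (fun y => quadForm A y * (linForm a y * linForm b y)) =
      signMean (fun y => quadForm A y * (linForm a y * linForm b y - p)) := by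
    have : signMean (fun y => p * quadForm A y) = 0 := by
      rw [signMean_const_mul, signMean_quadForm, mul_zero]
    rw [← sub_zero (signMean _), ← this, ← signMean_sub]
    congr 1; ext y; ring
  have e2 : signMean (fun y => (linForm a y * linForm b y - p) ^ 2) =
      signMean (fun y => linForm a y ^ 2 * linForm b y ^ 2) - p ^ 2 := by
    have h1 : p ^ 2 = 2 * p * p - p ^ 2 := by ring
    rw [h1]
    nth_rewrite 3 [hp]
    rw [← signMean_linForm_mul, ← signMean_const_mul, ← signMean_const (n := n) (p ^ 2),
      ← signMean_sub, ← signMean_sub]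
    congr 1; ext y; ring
  have hc : p ^ 2 ≤ (∑ i, a i ^ 2) * (∑ i, b i ^ 2) := Finset.sum_mul_sq_le_sq_mul_sq _ _ _
  have h4 := signMean_linForm_sq_mul_sq_le a b
  rw [e1]
  refine (signMean_mul_sq_le _ _).trans ?_
  rw [signMean_quadForm_sq, e2]
  nlinarith [upperSq_nonneg A]

/-- The constant 5 is what the fourth moment needs: there the cross term 6·5 matches 2·15. Induction
conditions on the first sign, writing Q = y₀ℓ + Q'. -/
theorem signMean_quadForm_sq_mul_linForm_sq_le {n : ℕ} (A : Fin n → Fin n → ℝ)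
    (a : Fin n → ℝ) :
    signMean (fun y => quadForm A y ^ 2 * linForm a y ^ 2) ≤ 5 * upperSq A * ∑ i, a i ^ 2 := by
  induction n with
  | zero => simp [signMean_zero_dim, quadForm, upperSq]
  | succ n ih =>
    set A' : Fin n → Fin n → ℝ := fun i j => A i.succ j.succ with hA
    set l : Fin n → ℝ := fun j => A 0 j.succ with hl
    set m : Fin n → ℝ := fun j => a j.succ with hm
    have h := ih A' m
    have e : signMean (fun y => quadForm A y ^ 2 * linForm a y ^ 2) =
        signMean (fun y => quadForm A' y ^ 2 * linForm m y ^ 2)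
        + a 0 ^ 2 * (∑ i, l i ^ 2) + a 0 ^ 2 * upperSq A'
        + signMean (fun y => linForm l y ^ 2 * linForm m y ^ 2)
        + 4 * a 0 * signMean (fun y => quadForm A' y * (linForm l y * linForm m y)) := by
      rw [← signMean_quadForm_sq, ← signMean_linForm_sq, signMean_succ,
        ← signMean_const_mul, ← signMean_const_mul, ← signMean_const_mul, ← signMean_add,
        ← signMean_add, ← signMean_add, ← signMean_add]
      congr 1; ext y
      simp only [linForm_cons, quadForm_cons, Units.val_one, Units.val_neg, Int.cast_one,
        Int.cast_neg, ← hA, ← hl, ← hm]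
      ring
    have h2 := signMean_linForm_sq_mul_sq_le l m
    have hc : (∑ i, l i * m i) ^ 2 ≤ (∑ i, l i ^ 2) * (∑ i, m i ^ 2) :=
      Finset.sum_mul_sq_le_sq_mul_sq _ _ _
    have h3 := signMean_quadForm_mul_linForm_mul_linForm_sq_le A' l m
    rw [e, upperSq_succ, Fin.sum_univ_succ]
    change _ ≤ 5 * ((∑ i, l i ^ 2) + upperSq A') * (a 0 ^ 2 + ∑ i, m i ^ 2)
    have hr := upperSq_nonneg A'
    have hL : 0 ≤ ∑ i, l i ^ 2 := Finset.sum_nonneg fun i _ => sq_nonneg _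
    have hM : 0 ≤ ∑ i, m i ^ 2 := Finset.sum_nonneg fun i _ => sq_nonneg _
    generalize signMean (fun y => quadForm A' y * (linForm l y * linForm m y)) = w at *
    generalize upperSq A' = r at *
    generalize ∑ i, l i ^ 2 = L at *
    generalize ∑ i, m i ^ 2 = K at *
    generalize a 0 = s at *
    -- AM–GM, split so that s²r and LK each reach the coefficient 5: 1 + 4 and 3 + 2.
    have key : 4 * s * w ≤ 4 * s ^ 2 * r + 2 * (L * K) := by
      have hX : 0 ≤ 4 * s ^ 2 * r + 2 * (L * K) := by positivity
      have : (4 * s * w) ^ 2 ≤ (4 * s ^ 2 * r + 2 * (L * K)) ^ 2 := by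
        have h5 : s ^ 2 * w ^ 2 ≤ s ^ 2 * (2 * r * (L * K)) :=
          mul_le_mul_of_nonneg_left h3 (sq_nonneg s)
        nlinarith [sq_nonneg (4 * s ^ 2 * r - 2 * (L * K))]
      exact (abs_le_of_sq_le_sq' this hX).2
    have : 0 ≤ s ^ 2 * L := by positivity
    nlinarith

theorem signMean_quadForm_pow_four_le {n : ℕ} (A : Fin n → Fin n → ℝ) :
    signMean (fun y => quadForm A y ^ 4) ≤ 15 * upperSq A ^ 2 := by
  induction n with
  | zero => simp [signMean_zero_dim, quadForm, upperSq]
  | succ n ih =>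
    set A' : Fin n → Fin n → ℝ := fun i j => A i.succ j.succ with hA
    set l : Fin n → ℝ := fun j => A 0 j.succ with hl
    have h := ih A'
    have e : signMean (fun y => quadForm A y ^ 4) =
        signMean (fun y => quadForm A' y ^ 4)
        + 6 * signMean (fun y => quadForm A' y ^ 2 * linForm l y ^ 2)
        + signMean (fun y => linForm l y ^ 2 * linForm l y ^ 2) := by
      rw [signMean_succ, ← signMean_const_mul, ← signMean_add, ← signMean_add]
      congr 1; ext y
      simp only [quadForm_cons, Units.val_one, Units.val_neg, Int.cast_one,
        Int.cast_neg, ← hA, ← hl]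
      ring
    have h2 := signMean_linForm_sq_mul_sq_le l l
    have h3 := signMean_quadForm_sq_mul_linForm_sq_le A' l
    rw [e, upperSq_succ]
    change _ ≤ 15 * ((∑ i, l i ^ 2) + upperSq A') ^ 2
    simp only [← sq] at h2
    rw [show (fun y => linForm l y ^ 2 * linForm l y ^ 2) = fun y => (linForm l y ^ 2) ^ 2 by
      ext; ring]
    nlinarith [sq_nonneg (∑ i, l i ^ 2)]

/-! ### Gaussian integrals over intervals and discs -/

section

open MeasureTheory

theorem integral_disc_gaussian {b R : ℝ} (hb : 0 < b) (hR : 0 ≤ R) :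
    ∫ p : ℝ × ℝ in {p | p.1 ^ 2 + p.2 ^ 2 ≤ R ^ 2}, Real.exp (-b * (p.1 ^ 2 + p.2 ^ 2)) =
      Real.pi / b * (1 - Real.exp (-b * R ^ 2)) := by
  have hm : MeasurableSet {p : ℝ × ℝ | p.1 ^ 2 + p.2 ^ 2 ≤ R ^ 2} :=
    (isClosed_le (by fun_prop) (by fun_prop)).measurableSet
  rw [← integral_indicator hm, ← integral_comp_polarCoord_symm]
  have e : ∀ p ∈ polarCoord.target, p.1 • ({p : ℝ × ℝ | p.1 ^ 2 + p.2 ^ 2 ≤ R ^ 2}.indicator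
      (fun p => Real.exp (-b * (p.1 ^ 2 + p.2 ^ 2))) (polarCoord.symm p)) =
      (Set.Iic R).indicator (fun r => r * Real.exp (-b * r ^ 2)) p.1 * 1 := by
    rintro ⟨r, θ⟩ hp
    have hr : 0 < r := by simpa using hp.1
    have h1 : (r * Real.cos θ) ^ 2 + (r * Real.sin θ) ^ 2 = r ^ 2 := by
      rw [mul_pow, mul_pow, ← mul_add, Real.cos_sq_add_sin_sq, mul_one]
    simp only [polarCoord_symm_apply, Set.indicator, Set.mem_ofPred_eq, Set.mem_Iic, h1,
      pow_le_pow_iff_left₀ hr.le hR two_ne_zero, smul_eq_mul, mul_one]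
    split_ifs <;> simp
  rw [setIntegral_congr_fun polarCoord.open_target.measurableSet e, polarCoord_target,
    Measure.volume_eq_prod, setIntegral_prod_mul (f := (Set.Iic R).indicator
      (fun r => r * Real.exp (-b * r ^ 2))) (g := fun _ => (1 : ℝ)),
    setIntegral_indicator measurableSet_Iic, Set.Ioi_inter_Iic,
    ← intervalIntegral.integral_of_le hR]
  have d : ∀ r ∈ Set.uIcc 0 R, HasDerivAt (fun r => -(Real.exp (-b * r ^ 2) / (2 * b)))
      (r * Real.exp (-b * r ^ 2)) r := by
    intro r _
    have h := ((((hasDerivAt_id r).pow 2).const_mul (-b)).exp.div_const (2 * b)).neg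
    refine h.congr_deriv ?_
    simp
    field_simp
  rw [intervalIntegral.integral_eq_sub_of_hasDerivAt d
    (Continuous.intervalIntegrable (by fun_prop) _ _)]
  simp
  rw [max_eq_left (by positivity)]
  field_simp
  ring

theorem integrable_gaussian_prod {b : ℝ} (hb : 0 < b) :
    Integrable (fun p : ℝ × ℝ => Real.exp (-b * (p.1 ^ 2 + p.2 ^ 2))) := by
  have h := (integrable_exp_neg_mul_sq hb).mul_prod (integrable_exp_neg_mul_sq hb)
  refine h.congr (ae_of_all _ fun p => ?_)
  simp only [← Real.exp_add]
  ring_nf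

theorem sq_integral_Icc_gaussian (b D : ℝ) :
    (∫ u in Set.Icc (-D) D, Real.exp (-b * u ^ 2)) ^ 2 =
      ∫ p in Set.Icc (-D) D ×ˢ Set.Icc (-D) D, Real.exp (-b * (p.1 ^ 2 + p.2 ^ 2)) := by
  rw [sq, Measure.volume_eq_prod, ← setIntegral_prod_mul]
  simp only [← Real.exp_add, mul_add]

/-- The square lies in its circumscribed disc, of radius √2·D. -/
theorem sq_integral_Icc_gaussian_le {b D : ℝ} (hb : 0 < b) :
    (∫ u in Set.Icc (-D) D, Real.exp (-b * u ^ 2)) ^ 2 ≤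
      Real.pi / b * (1 - Real.exp (-(2 * b * D ^ 2))) := by
  have h := integral_disc_gaussian hb (R := Real.sqrt (2 * D ^ 2)) (Real.sqrt_nonneg _)
  rw [Real.sq_sqrt (by positivity)] at h
  rw [sq_integral_Icc_gaussian, show -(2 * b * D ^ 2) = -b * (2 * D ^ 2) by ring, ← h]
  refine setIntegral_mono_set (integrable_gaussian_prod hb).integrableOn
    (ae_of_all _ fun p => (Real.exp_pos _).le) (LE.le.eventuallyLE ?_)
  rintro ⟨u, v⟩ ⟨hu, hv⟩
  have := sq_le_sq' hu.1 hu.2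
  have := sq_le_sq' hv.1 hv.2
  simp only [Set.mem_ofPred_eq] at *
  linarith

/-- The square contains its inscribed disc, of radius D; hence the exponent of `L` is half that of
`U`. -/
theorem le_sq_integral_Icc_gaussian {b D : ℝ} (hb : 0 < b) (hD : 0 ≤ D) :
    Real.pi / b * (1 - Real.exp (-(b * D ^ 2))) ≤
      (∫ u in Set.Icc (-D) D, Real.exp (-b * u ^ 2)) ^ 2 := by
  rw [sq_integral_Icc_gaussian, ← neg_mul, ← integral_disc_gaussian hb hD]
  refine setIntegral_mono_set (integrable_gaussian_prod hb).integrableOn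
    (ae_of_all _ fun p => (Real.exp_pos _).le) (LE.le.eventuallyLE ?_)
  rintro ⟨u, v⟩ h
  simp only [Set.mem_ofPred_eq] at h
  exact ⟨abs_le_of_sq_le_sq' (by nlinarith [sq_nonneg v]) hD,
    abs_le_of_sq_le_sq' (by nlinarith [sq_nonneg u]) hD⟩

/-! ### Scalar inequalities behind the factors of U and L -/

/-- `sinh(as/2) / a` is monotone in `a`. -/
theorem one_sub_exp_div_le {a s : ℝ} (ha : 0 < a) (ha1 : a ≤ 1) (hs : 0 ≤ s) :
    (1 - Real.exp (-(a * s))) / a ≤ (1 - Real.exp (-s)) * Real.exp ((1 - a) * s / 2) := by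
  have hc : ConvexOn ℝ (Set.Ici 0) Real.sinh := by
    refine convexOn_of_deriv2_nonneg (convex_Ici 0) Real.continuous_sinh.continuousOn
      Real.differentiable_sinh.differentiableOn ?_ ?_
    · simpa using Real.differentiable_cosh.differentiableOn
    · intro x hx
      simp only [interior_Ici, Set.mem_Ioi] at hx
      simpa using hx.le
  have h := hc.2 (x := s / 2) (y := 0) (Set.mem_Ici.2 (by positivity)) (by simp) ha.le
    (sub_nonneg.2 ha1) (by ring)
  simp only [smul_eq_mul, mul_zero, add_zero, Real.sinh_zero] at h
  rw [Real.sinh_eq, Real.sinh_eq] at h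
  rw [div_le_iff₀ ha]
  have e1 : 1 - Real.exp (-(a * s)) =
      (Real.exp (a * (s / 2)) - Real.exp (-(a * (s / 2)))) * Real.exp (-(a * s / 2)) := by
    rw [sub_mul, ← Real.exp_add, ← Real.exp_add, ← Real.exp_zero]
    congr 2 <;> ring
  have e2 : (1 - Real.exp (-s)) * Real.exp ((1 - a) * s / 2) =
      (Real.exp (s / 2) - Real.exp (-(s / 2))) * Real.exp (-(a * s / 2)) := by
    rw [sub_mul (1 : ℝ) (Real.exp (-s)), sub_mul (Real.exp (s / 2)), one_mul, ← Real.exp_add,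
      ← Real.exp_add, ← Real.exp_add]
    congr 2 <;> ring
  rw [e1, e2]
  have := mul_le_mul_of_nonneg_right h (Real.exp_pos (-(a * s / 2))).le
  linarith

theorem exp_le_one_add_add_sq {u : ℝ} (h0 : 0 ≤ u) (h1 : u ≤ 1) :
    Real.exp u ≤ 1 + u + u ^ 2 := by
  have := Real.abs_exp_sub_one_sub_id_le (x := u) (by rwa [abs_of_nonneg h0])
  linarith [(abs_le.1 this).2]

/-- The exponent is x⁴/16 + 3x⁶/64: the cost per step of the weakened Gaussian in the upper bound.
Its two terms are absorbed by the two factors separately. -/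
theorem exp_budget_le {x : ℝ} (h0 : 0 ≤ x) (h1 : x ≤ 1) :
    Real.exp ((x ^ 2 / 2 + 3 / 8 * x ^ 4) * x ^ 2 / 8) ≤
      (1 + 1 / 12 * x ^ 4) * Real.sqrt (1 + 1 / 9 * x ^ 6) := by
  have h4 : x ^ 4 ≤ 1 := pow_le_one₀ h0 h1
  have h6 : x ^ 6 ≤ 1 := pow_le_one₀ h0 h1
  have p4 : 0 ≤ x ^ 4 := by positivity
  have p6 : 0 ≤ x ^ 6 := by positivity
  rw [show (x ^ 2 / 2 + 3 / 8 * x ^ 4) * x ^ 2 / 8 = x ^ 4 / 16 + 3 / 64 * x ^ 6 by ring,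
    Real.exp_add]
  have a1 := exp_le_one_add_add_sq (u := x ^ 4 / 16) (by positivity) (by linarith)
  have a2 := exp_le_one_add_add_sq (u := 3 / 32 * x ^ 6) (by positivity) (by linarith)
  refine mul_le_mul (by nlinarith) ?_ (Real.exp_pos _).le (by positivity)
  apply Real.le_sqrt_of_sq_le
  rw [← Real.exp_nat_mul, show ((2 : ℕ) : ℝ) * (3 / 64 * x ^ 6) = 3 / 32 * x ^ 6 by
    push_cast; ring]
  nlinarith

/-- The logarithm of the left side is -r + r² + (7/6)r³ + …, so the cubic coefficient 3/2 leaves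
room. -/
theorem one_sub_add_sq_le_exp {r : ℝ} (h0 : 0 ≤ r) (h1 : r ≤ 1 / 2) :
    1 - r + 3 / 2 * r ^ 2 ≤ Real.exp (-r + r ^ 2 + 3 / 2 * r ^ 3) := by
  set q : ℝ := 1 - r - 3 / 2 * r ^ 2 with hq
  have q0 : 0 ≤ q := by nlinarith
  have q1 : q ≤ 1 := by nlinarith
  have hw0 : 0 ≤ r * q := mul_nonneg h0 q0
  have hw1 : r * q ≤ 1 := by nlinarith
  rw [show -r + r ^ 2 + 3 / 2 * r ^ 3 = -(r * q) by rw [hq]; ring]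
  -- Second-order Taylor at -rq; the remainder bound is (2/9)(rq)³.
  have h := Real.exp_bound (x := -(r * q)) (by rwa [abs_neg, abs_of_nonneg hw0]) (n := 3)
    (by norm_num)
  rw [abs_neg, abs_of_nonneg hw0] at h
  have h' := (abs_le.1 h).1
  norm_num [Finset.sum_range_succ, Nat.factorial] at h'
  have q3 : q ^ 3 ≤ q := by
    calc q ^ 3 = q * q ^ 2 := by ring
      _ ≤ q * 1 := by gcongr; exact pow_le_one₀ q0 q1
      _ = q := mul_one q
  have key : 0 ≤ r ^ 3 * (1 / 2 - r + 3 / 2 * r ^ 2 + 9 / 8 * r ^ 3 - 2 / 9 * q ^ 3) := by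
    refine mul_nonneg (by positivity) ?_
    nlinarith [sq_nonneg (r - 1 / 5), pow_nonneg h0 3]
  have e : 1 - r * q + (r * q) ^ 2 / 2 - (r * q) ^ 3 * (2 / 9) - (1 - r + 3 / 2 * r ^ 2) =
      r ^ 3 * (1 / 2 - r + 3 / 2 * r ^ 2 + 9 / 8 * r ^ 3 - 2 / 9 * q ^ 3) := by
    rw [hq]; ring
  linarith

/-- For z = a + ib, |arg z| ≤ tan |arg z| = |b|/a ≤ θ, while Re z^T = |z|^T cos(T arg z) and cos u ≥
1 - u²/2. -/
theorem re_pow_ge {a b θ : ℝ} (ha : 0 < a) (hb : |b| ≤ θ * a) (T : ℕ)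
    (hT : (T : ℝ) * θ ≤ 1) :
    a ^ T * (1 - (T * θ) ^ 2 / 2) ≤ ((⟨a, b⟩ : ℂ) ^ T).re := by
  set z : ℂ := ⟨a, b⟩ with hz
  have hlt : |z.arg| < Real.pi / 2 := Complex.abs_arg_lt_pi_div_two_iff.2 (Or.inl ha)
  have hθ : |z.arg| ≤ θ := by
    have h1 := Real.le_tan (abs_nonneg z.arg) hlt
    have h2 : Real.tan |z.arg| = |b| / a := by
      rcases abs_cases z.arg with ⟨h, h'⟩ | ⟨h, h'⟩
      · have := Complex.arg_nonneg_iff.1 h'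
        rw [h, Complex.tan_arg, abs_of_nonneg this]
      · have := Complex.arg_neg_iff.1 h'
        rw [h, Real.tan_neg, Complex.tan_arg, abs_of_neg this, neg_div]
    rw [h2] at h1
    exact h1.trans (by rwa [div_le_iff₀ ha])
  have hre : (z ^ T).re = ‖z‖ ^ T * Real.cos (T * z.arg) := by
    conv_lhs => rw [← Complex.norm_mul_exp_arg_mul_I z, mul_pow, ← Complex.exp_nat_mul, ← mul_assoc,
      ← Complex.ofReal_natCast, ← Complex.ofReal_mul, ← Complex.ofReal_pow, Complex.re_ofReal_mul,
      Complex.exp_ofReal_mul_I_re]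
  have hcos := Real.one_sub_sq_div_two_le_cos (x := T * z.arg)
  have h0 : 0 ≤ (T : ℝ) * θ := mul_nonneg (Nat.cast_nonneg _) ((abs_nonneg _).trans hθ)
  have hsq : (T * z.arg) ^ 2 ≤ (T * θ) ^ 2 := by
    rw [mul_pow, mul_pow, ← sq_abs z.arg]
    gcongr
  have h1 : (T * θ) ^ 2 ≤ 1 := pow_le_one₀ h0 hT
  rw [hre]
  refine mul_le_mul (pow_le_pow_left₀ ha.le ?_ _) (by linarith) (by linarith) (by positivity)
  exact (le_abs_self _).trans (Complex.abs_re_le_norm z)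

theorem lower_factor_le {τ : ℝ} (h0 : 0 ≤ τ) (h1 : τ ≤ 1) :
    (1 + 4 / 9 * τ ^ 2) ^ (-(1 / 2) : ℝ) ≤ 1 - τ ^ 2 / 8 := by
  have hp : 0 < 1 + 4 / 9 * τ ^ 2 := by positivity
  have ht : τ ^ 2 ≤ 1 := pow_le_one₀ h0 h1
  rw [Real.rpow_neg hp.le, ← Real.sqrt_eq_rpow]
  apply inv_le_of_inv_le₀ (by linarith)
  apply Real.le_sqrt_of_sq_le
  rw [inv_pow]
  apply inv_le_of_inv_le₀ hp
  rw [inv_le_iff_one_le_mul₀ hp]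
  have h2 : 0 ≤ τ ^ 2 := sq_nonneg τ
  nlinarith [mul_nonneg h2 (sub_nonneg.2 ht), pow_nonneg h2 3]

end

/-! ### The characteristic function near the origin -/

section

open MeasureTheory

/-- With u = 2v, cos u = 1 - 2 sin² v, and sin v ≥ v - v³/6 can be squared when v² ≤ 6; beyond that
the quartic exceeds 1. -/
theorem cos_le_quartic (u : ℝ) : Real.cos u ≤ 1 - u ^ 2 / 2 + u ^ 4 / 24 := by
  wlog hu : 0 ≤ u generalizing u
  · simpa [Even.neg_pow (by decide : Even 4)] using this (-u) (by linarith)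
  obtain ⟨v, rfl⟩ : ∃ v, u = 2 * v := ⟨u / 2, by ring⟩
  have hv : 0 ≤ v := by linarith
  rw [Real.cos_two_mul, ← Real.sin_sq_add_cos_sq v]
  rw [Real.cos_sq']
  by_cases h : v ^ 2 ≤ 6
  · have h1 := Real.sin_ge_sub_cube hv
    have h2 : 0 ≤ v - v ^ 3 / 6 := by nlinarith
    have h3 := pow_le_pow_left₀ h2 h1 2
    nlinarith [pow_nonneg hv 6]
  · push Not at h
    nlinarith [sq_nonneg (Real.sin v)]

theorem abs_sin_sub_le (u : ℝ) : |Real.sin u - u| ≤ |u| * u ^ 2 / 6 := by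
  wlog hu : 0 ≤ u generalizing u
  · have := this (-u) (by linarith)
    rw [Real.sin_neg, ← abs_neg] at this
    simpa [add_comm, sub_eq_add_neg] using this
  rw [abs_of_nonneg hu, abs_le]
  have h1 := Real.sin_ge_sub_cube hu
  have h2 := Real.sin_le hu
  have : 0 ≤ u * u ^ 2 / 6 := by positivity
  exact ⟨by linarith, by linarith⟩

variable {n : ℕ}

/-- The pairing of a dual vector with the increment `Z y`. -/
noncomputable def pairing (l : Edge n → ℝ) (y : Fin n → ℤˣ) : ℝ := ∑ e, l e * (Z y e : ℝ)

/-- The characteristic function of one step of the walk. -/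
noncomputable def charFn (l : Edge n → ℝ) : ℂ :=
  (∑ y, Complex.exp (pairing l y * Complex.I)) / 2 ^ n

/-- The symmetric matrix with zero diagonal whose upper entries are those of `l`. -/
noncomputable def symMat (l : Edge n → ℝ) (i j : Fin n) : ℝ :=
  if h : i < j then l ⟨(i, j), h⟩ else if h : j < i then l ⟨(j, i), h⟩ else 0

theorem sum_edge_eq {E : Type*} [AddCommMonoid E] (f : Fin n → Fin n → E) :
    ∑ e : Edge n, f e.1.1 e.1.2 = ∑ i, ∑ j, if i < j then f i j else 0 := by
  rw [← Fintype.sum_prod_type' (f := fun i j => if i < j then f i j else 0), ← Finset.sum_filter]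
  exact (Finset.sum_subtype (Finset.univ.filter fun p : Fin n × Fin n => p.1 < p.2) (by simp)
    fun p => f p.1 p.2).symm

theorem symMat_edge (l : Edge n → ℝ) (e : Edge n) : symMat l e.1.1 e.1.2 = l e := by
  simp [symMat, e.2]

theorem pairing_eq_quadForm (l : Edge n → ℝ) (y : Fin n → ℤˣ) :
    pairing l y = quadForm (symMat l) y := by
  unfold pairing quadForm
  rw [← sum_edge_eq fun i j => symMat l i j * (((y i : ℤ) : ℝ) * ((y j : ℤ) : ℝ))]
  exact Finset.sum_congr rfl fun e _ => by simp [symMat_edge, Z]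

theorem sum_sq_eq_upperSq (l : Edge n → ℝ) : ∑ e, l e ^ 2 = upperSq (symMat l) := by
  unfold upperSq
  rw [← sum_edge_eq fun i j => symMat l i j ^ 2]
  simp only [symMat_edge]

theorem charFn_re (l : Edge n → ℝ) :
    (charFn l).re = signMean fun y => Real.cos (pairing l y) := by
  unfold charFn signMean
  rw [← Nat.cast_two, ← Nat.cast_pow, Complex.div_natCast_re]
  simp [Complex.exp_ofReal_mul_I_re]

theorem charFn_im (l : Edge n → ℝ) :
    (charFn l).im = signMean fun y => Real.sin (pairing l y) := by
  unfold charFn signMean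
  rw [← Nat.cast_two, ← Nat.cast_pow, Complex.div_natCast_im]
  simp [Complex.exp_ofReal_mul_I_im]

theorem charFn_re_ge (l : Edge n → ℝ) : 1 - (∑ e, l e ^ 2) / 2 ≤ (charFn l).re := by
  rw [charFn_re, sum_sq_eq_upperSq, ← signMean_quadForm_sq, div_eq_inv_mul,
    ← signMean_const_mul, ← signMean_const (n := n) 1, ← signMean_sub]
  refine signMean_mono fun y => ?_
  rw [pairing_eq_quadForm, ← div_eq_inv_mul]
  exact Real.one_sub_sq_div_two_le_cos

theorem charFn_re_le (l : Edge n → ℝ) :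
    (charFn l).re ≤ 1 - (∑ e, l e ^ 2) / 2 + 5 / 8 * (∑ e, l e ^ 2) ^ 2 := by
  have h : (charFn l).re ≤ 1 - (1 / 2) * signMean (fun y => quadForm (symMat l) y ^ 2) +
      (1 / 24) * signMean (fun y => quadForm (symMat l) y ^ 4) := by
    rw [charFn_re, ← signMean_const_mul, ← signMean_const_mul, ← signMean_const (n := n) 1,
      ← signMean_sub, ← signMean_add]
    refine signMean_mono fun y => ?_
    rw [pairing_eq_quadForm, signMean_const]
    linarith [cos_le_quartic (quadForm (symMat l) y)]
  rw [signMean_quadForm_sq] at h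
  rw [sum_sq_eq_upperSq]
  linarith [signMean_quadForm_pow_four_le (symMat l)]

/-- As E Q = 0, sin Q may be replaced by sin Q - Q, which is at most |Q|³/6. Cauchy–Schwarz gives
(E|Q|³)² ≤ E Q² · E Q⁴ ≤ 15r³, and 15/36 = 5/12. -/
theorem charFn_im_sq_le (l : Edge n → ℝ) :
    (charFn l).im ^ 2 ≤ 5 / 12 * (∑ e, l e ^ 2) ^ 3 := by
  set A := symMat l
  have h : |(charFn l).im| ≤ 1 / 6 * signMean (fun y => |quadForm A y| * quadForm A y ^ 2) := by
    have e : (charFn l).im = signMean fun y => Real.sin (quadForm A y) - quadForm A y := by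
      rw [signMean_sub, charFn_im]
      simp only [pairing_eq_quadForm]
      rw [show signMean (fun y => quadForm A y) = 0 from signMean_quadForm A, sub_zero]
    rw [e, ← signMean_const_mul]
    refine (abs_signMean_le _).trans (signMean_mono fun y => ?_)
    linarith [abs_sin_sub_le (quadForm A y)]
  have h2 := signMean_mul_sq_le (fun y => |quadForm A y|) (fun y => quadForm A y ^ 2)
  simp only [sq_abs, ← pow_mul] at h2
  rw [signMean_quadForm_sq] at h2
  have h3 : upperSq A * signMean (fun y => quadForm A y ^ (2 * 2)) ≤
      upperSq A * (15 * upperSq A ^ 2) :=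
    mul_le_mul_of_nonneg_left (signMean_quadForm_pow_four_le A) (upperSq_nonneg A)
  rw [sum_sq_eq_upperSq, ← sq_abs]
  have h4 := pow_le_pow_left₀ (abs_nonneg _) h 2
  rw [mul_pow] at h4
  nlinarith

theorem normSq_charFn_le (l : Edge n → ℝ) (h : ∑ e, l e ^ 2 ≤ 1 / 2) :
    ‖charFn l‖ ^ 2 ≤ 1 - ∑ e, l e ^ 2 + 3 / 2 * (∑ e, l e ^ 2) ^ 2 := by
  have h1 := charFn_re_ge l
  have h2 := charFn_re_le l
  have h3 := charFn_im_sq_le l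
  have h0 : 0 ≤ ∑ e, l e ^ 2 := Finset.sum_nonneg fun _ _ => sq_nonneg _
  rw [← Complex.normSq_eq_norm_sq, Complex.normSq_apply, ← sq, ← sq]
  generalize ∑ e, l e ^ 2 = r at *
  have h4 := pow_le_pow_left₀ (by linarith : 0 ≤ (charFn l).re) h2 2
  -- Beyond the stated terms the sum of squares leaves -(5/24)r³ + (25/64)r⁴, negative or zero for r
  -- ≤ 1/2.
  nlinarith [mul_nonneg (pow_nonneg h0 3) (sub_nonneg.2 h)]

/-- The correction r² + (3/2)r³ is at most r(x²/2 + 3x⁴/8), so it only reduces the rate of the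
Gaussian. -/
theorem norm_charFn_pow_le (l : Edge n → ℝ) {x : ℝ} (hx : x ≤ 1) (hx0 : 0 ≤ x)
    (h : ∑ e, l e ^ 2 ≤ x ^ 2 / 2) (T : ℕ) :
    ‖charFn l‖ ^ T ≤
      Real.exp (-(T / 2 * (1 - (x ^ 2 / 2 + 3 / 8 * x ^ 4))) * ∑ e, l e ^ 2) := by
  have hx2 : x ^ 2 ≤ 1 := pow_le_one₀ hx0 hx
  have h0 : 0 ≤ ∑ e, l e ^ 2 := Finset.sum_nonneg fun _ _ => sq_nonneg _
  have h1 := normSq_charFn_le l (by linarith)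
  generalize ∑ e, l e ^ 2 = r at *
  have h2 := one_sub_add_sq_le_exp h0 (by linarith)
  have h3 : -r + r ^ 2 + 3 / 2 * r ^ 3 ≤ -((1 - (x ^ 2 / 2 + 3 / 8 * x ^ 4)) * r) := by
    have : r ^ 2 ≤ (x ^ 2 / 2) ^ 2 := pow_le_pow_left₀ h0 h 2
    nlinarith
  have h4 : ‖charFn l‖ ≤ Real.exp (-((1 - (x ^ 2 / 2 + 3 / 8 * x ^ 4)) * r) / 2) := by
    refine le_of_sq_le_sq ?_ (Real.exp_pos _).le
    rw [← Real.exp_nat_mul]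
    refine (h1.trans h2).trans (Real.exp_le_exp.2 ?_)
    push_cast
    linarith
  refine (pow_le_pow_left₀ (norm_nonneg _) h4 T).trans (le_of_eq ?_)
  rw [← Real.exp_nat_mul]
  congr 1
  ring

theorem re_charFn_pow_ge (l : Edge n → ℝ) {x : ℝ} (hx : x ≤ 1) (hx0 : 0 ≤ x)
    (h : ∑ e, l e ^ 2 ≤ x ^ 2 / 2) (T : ℕ) (hT : (T : ℝ) * x ^ 3 ≤ 1) :
    (1 + 4 / 9 * (T * x ^ 3) ^ 2) ^ (-(1 / 2) : ℝ) * (1 - 1 / 12 * x ^ 4) ^ T *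
      Real.exp (-(T / 2) * ∑ e, l e ^ 2) ≤ (charFn l ^ T).re := by
  have hx2 : x ^ 2 ≤ 1 := pow_le_one₀ hx0 hx
  have hx4 : x ^ 4 ≤ 1 := pow_le_one₀ hx0 hx
  have h0 : 0 ≤ ∑ e, l e ^ 2 := Finset.sum_nonneg fun _ _ => sq_nonneg _
  have h1 := charFn_re_ge l
  have h3 := charFn_im_sq_le l
  generalize ∑ e, l e ^ 2 = r at *
  have ha : 3 / 4 ≤ (charFn l).re := by linarith
  -- The squared tangent of the argument is at most (5/12)(x²/2)³/(3/4)², below (x³/2)².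
  have hb : |(charFn l).im| ≤ x ^ 3 / 2 * (charFn l).re := by
    have e1 : r ^ 3 ≤ (x ^ 2 / 2) ^ 3 := pow_le_pow_left₀ h0 h 3
    refine le_of_sq_le_sq ?_ (by positivity)
    have e2 : (3 / 4 : ℝ) ^ 2 ≤ (charFn l).re ^ 2 := pow_le_pow_left₀ (by norm_num) ha 2
    rw [sq_abs, mul_pow]
    have : (x ^ 3 / 2) ^ 2 * (3 / 4 : ℝ) ^ 2 ≤ (x ^ 3 / 2) ^ 2 * (charFn l).re ^ 2 := by gcongr
    nlinarith [pow_nonneg hx0 6]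
  have hp : 0 ≤ (T : ℝ) * x ^ 3 := by positivity
  have main := re_pow_ge (by linarith) hb T (by linarith)
  -- (1 - r/2)e^{r/2} ≥ (1 - r/2)(1 + r/2 + r²/8) = 1 - r²/8 - r³/16, with r ≤ x²/2.
  have e3 : (1 - 1 / 12 * x ^ 4) * Real.exp (-r / 2) ≤ (charFn l).re := by
    refine le_trans ?_ h1
    have b1 := Real.quadratic_le_exp_of_nonneg (x := r / 2) (by linarith)
    rw [neg_div, Real.exp_neg, ← div_eq_mul_inv, div_le_iff₀ (Real.exp_pos _)]
    have : r ^ 2 ≤ (x ^ 2 / 2) ^ 2 := pow_le_pow_left₀ h0 h 2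
    nlinarith [mul_le_mul_of_nonneg_left b1 (by linarith : 0 ≤ 1 - r / 2)]
  have e4 : (1 - 1 / 12 * x ^ 4) ^ T * Real.exp (-(T / 2) * r) ≤ (charFn l).re ^ T := by
    have := pow_le_pow_left₀ (mul_nonneg (by linarith) (Real.exp_pos _).le) e3 T
    rw [mul_pow, ← Real.exp_nat_mul] at this
    rwa [show (T : ℝ) * (-r / 2) = -(T / 2) * r by ring] at this
  have e5 := lower_factor_le hp hT
  calc _ = ((1 - 1 / 12 * x ^ 4) ^ T * Real.exp (-(T / 2) * r)) *
        (1 + 4 / 9 * (T * x ^ 3) ^ 2) ^ (-(1 / 2) : ℝ) := by ring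
    _ ≤ (charFn l).re ^ T * (1 - (T * x ^ 3) ^ 2 / 8) := by
        refine mul_le_mul e4 e5 (by positivity) (by positivity)
    _ = (charFn l).re ^ T * (1 - (T * (x ^ 3 / 2)) ^ 2 / 2) := by ring
    _ ≤ _ := main

/-- The cube `[-R, R]^d` in the dual space. -/
def cube (n : ℕ) (R : ℝ) : Set (Edge n → ℝ) := Set.univ.pi fun _ => Set.Icc (-R) R

theorem integral_cube_gaussian (b R : ℝ) :
    ∫ l in cube n R, Real.exp (-b * ∑ e, l e ^ 2) =
      (∫ u in Set.Icc (-R) R, Real.exp (-b * u ^ 2)) ^ Fintype.card (Edge n) := by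
  unfold cube
  rw [volume_pi, Measure.restrict_pi_pi, ← integral_fintype_prod_eq_pow]
  simp only [← Real.exp_sum, Finset.mul_sum]

theorem card_edge (n : ℕ) : Fintype.card (Edge n) = n.choose 2 := by
  have h : Fintype.card (Edge n) = ∑ e : Edge n, 1 := by simp
  rw [h, sum_edge_eq fun _ _ => 1, Nat.choose_two_right, ← Finset.sum_range_id,
    ← Fin.sum_univ_eq_sum_range (fun i => i), Finset.sum_comm]
  refine Finset.sum_congr rfl fun j _ => ?_
  rw [← Finset.card_filter, Finset.filter_gt_eq_Iio, Fin.card_Iio]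

theorem sum_sq_le_of_mem_cube {l : Edge n → ℝ} {R : ℝ} (h : l ∈ cube n R) :
    ∑ e, l e ^ 2 ≤ (n * R) ^ 2 / 2 := by
  have h1 : ∑ e, l e ^ 2 ≤ ∑ _e : Edge n, R ^ 2 :=
    Finset.sum_le_sum fun e _ => sq_le_sq' (h e trivial).1 (h e trivial).2
  have h2 : ((n.choose 2 : ℕ) : ℝ) ≤ n ^ 2 / 2 := by
    rw [Nat.cast_choose_two]
    nlinarith [(Nat.cast_nonneg n : (0 : ℝ) ≤ n)]
  rw [Finset.sum_const, Finset.card_univ, card_edge, nsmul_eq_mul] at h1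
  nlinarith [sq_nonneg R]

end

/-! ### The walk as an average over signs, and Fourier inversion -/

section

open MeasureTheory

variable {n : ℕ}

theorem Z_mul (y w : Fin n → ℤˣ) : Z (y * w) = Z y * Z w := by
  ext e
  simp [Z]
  ring

theorem Z_mul_self (y : Fin n → ℤˣ) : Z y * Z y = 1 := by
  rw [← Z_mul, show y * y = 1 from funext fun i => Int.units_mul_self (y i)]
  ext e
  simp [Z]

/-- `Z` is multiplicative, so its fibres are cosets of one kernel; multiplication by w exchanges the
two. -/
theorem card_fiber_Z (w : Fin n → ℤˣ) :
    (Finset.univ.filter fun y : Fin n → ℤˣ => Z y = Z w).card =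
      (Finset.univ.filter fun y : Fin n → ℤˣ => Z y = 1).card := by
  have hw : w * w = 1 := funext fun i => Int.units_mul_self (w i)
  refine Finset.card_nbij' (· * w) (· * w) ?_ ?_ ?_ ?_
  · intro y hy
    simp only [Finset.coe_filter, Finset.mem_univ, true_and, Set.mem_ofPred_eq] at hy ⊢
    rw [Z_mul, hy, Z_mul_self]
  · intro y hy
    simp only [Finset.coe_filter, Finset.mem_univ, true_and, Set.mem_ofPred_eq] at hy ⊢
    rw [Z_mul, hy, one_mul]
  · intro y _
    simp [mul_assoc, hw]
  · intro y _
    simp [mul_assoc, hw]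

/-- Averaging over the set `M n` is the same as averaging over sign vectors. -/
theorem sum_M_div_card (f : (Edge n → ℤ) → ℝ) :
    (∑ m ∈ M n, f m) / (M n).card = (∑ y, f (Z y)) / 2 ^ n := by
  set K := (Finset.univ.filter fun y : Fin n → ℤˣ => Z y = 1).card
  have key : ∀ g : (Edge n → ℤ) → ℝ, ∑ y, g (Z y) = K * ∑ m ∈ M n, g m := by
    intro g
    rw [Finset.sum_comp g Z, Finset.mul_sum]
    refine Finset.sum_congr rfl fun m hm => ?_
    obtain ⟨w, -, rfl⟩ := Finset.mem_image.1 hm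
    rw [card_fiber_Z, nsmul_eq_mul]
  have h1 := key fun _ => 1
  have hK : (K : ℝ) ≠ 0 := by
    rintro h
    rw [h] at h1
    simp at h1
  have hM : ((M n).card : ℝ) ≠ 0 := by
    simpa using (M_nonempty n).ne_empty
  simp only [Finset.sum_const, nsmul_eq_mul, mul_one, Finset.card_univ, Fintype.card_fun,
    Fintype.card_units_int, Fintype.card_fin, Nat.cast_pow, Nat.cast_ofNat] at h1
  rw [key, h1, mul_div_mul_left _ _ hK]

theorem walkLaw_succ_apply (x z : Edge n → ℤ) (t : ℕ) :
    walkLaw n x (t + 1) z = ∑ m ∈ M n, ((M n).card : ENNReal)⁻¹ * walkLaw n x t (z - m) := by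
  have h : walkLaw n x (t + 1) = (PMF.uniformOfFinset (M n) (M_nonempty n)).bind fun m =>
      (walkLaw n x t).map fun w => w + m := by
    simp only [walkLaw, ← PMF.bind_pure_comp, Function.comp_def]
    exact PMF.bind_comm _ _ _
  rw [h, PMF.bind_apply, tsum_eq_sum (s := M n)]
  · refine Finset.sum_congr rfl fun m hm => ?_
    rw [PMF.uniformOfFinset_apply_of_mem _ hm, PMF.map_apply, tsum_eq_single (z - m)]
    · simp
    · intro w hw
      rw [if_neg]
      rintro rfl
      simp at hw
  · intro m hm
    rw [PMF.uniformOfFinset_apply_of_notMem _ hm, zero_mul]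

theorem P_succ (x z : Edge n → ℤ) (t : ℕ) :
    P n (t + 1) x z = (∑ y, P n t x (z - Z y)) / 2 ^ n := by
  unfold P
  rw [← sum_M_div_card fun m => (walkLaw n x t (z - m)).toReal, walkLaw_succ_apply,
    ENNReal.toReal_sum, Finset.sum_div]
  · refine Finset.sum_congr rfl fun m _ => ?_
    rw [ENNReal.toReal_mul, ENNReal.toReal_inv, ENNReal.toReal_natCast, mul_comm, div_eq_mul_inv]
  · intro m _
    refine ENNReal.mul_ne_top (ENNReal.inv_ne_top.2 ?_) (PMF.apply_ne_top _ _)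
    simpa using (M_nonempty n).ne_empty

theorem P_zero (x z : Edge n → ℤ) : P n 0 x z = if z = x then 1 else 0 := by
  unfold P walkLaw
  rw [PMF.pure_apply]
  split_ifs <;> simp

/-- The point `(π/2) m` of the dual space. -/
noncomputable def quarterShift (m : Edge n → Fin 4) (e : Edge n) : ℝ := Real.pi / 2 * (m e : ℕ)

/-- The four intervals tile one period. For z ≠ 0 the integrals are wʲ(w - 1) times a constant, with
w⁴ = 1, so their sum telescopes to zero. -/
theorem sum_integral_quarter (z : ℤ) :
    ∑ j : Fin 4, ∫ u in Set.Icc (-(Real.pi / 4)) (Real.pi / 4),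
      Complex.exp (-(((Real.pi / 2 * (j : ℕ) + u : ℝ) : ℂ) * z * Complex.I)) =
      if z = 0 then 2 * (Real.pi : ℂ) else 0 := by
  have hpi := Real.pi_pos
  split_ifs with hz
  · subst hz
    simp [Measure.real]
    rw [ENNReal.toReal_ofReal (by positivity)]
    push_cast
    ring
  · set c : ℂ := -(z * Complex.I) with hc
    have hc0 : c ≠ 0 := by simp [hc, hz]
    set w := Complex.exp (c * (Real.pi / 2)) with hw
    set s := Complex.exp (c * (-(Real.pi / 4))) with hs
    have hw4 : w ^ 4 = 1 := by
      rw [hw, ← Complex.exp_nat_mul, Complex.exp_eq_one_iff]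
      exact ⟨-z, by rw [hc]; push_cast; ring⟩
    have e : ∀ j : Fin 4, ∫ u in Set.Icc (-(Real.pi / 4)) (Real.pi / 4),
        Complex.exp (-(((Real.pi / 2 * (j : ℕ) + u : ℝ) : ℂ) * z * Complex.I)) =
        w ^ (j : ℕ) * (s * (w - 1) / c) := by
      intro j
      have e1 : ∀ u : ℝ, Complex.exp (-(((Real.pi / 2 * (j : ℕ) + u : ℝ) : ℂ) * z * Complex.I)) =
          w ^ (j : ℕ) * Complex.exp (c * u) := by
        intro u
        rw [hw, ← Complex.exp_nat_mul, ← Complex.exp_add, hc]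
        push_cast
        ring_nf
      simp only [e1]
      rw [integral_const_mul, integral_Icc_eq_integral_Ioc,
        ← intervalIntegral.integral_of_le (by linarith), integral_exp_mul_complex hc0]
      congr 2
      rw [mul_sub, hs, hw, ← Complex.exp_add, mul_one]
      push_cast
      ring_nf
    simp only [e, Fin.sum_univ_four]
    have : (w ^ 4 - 1) * s / c = 0 := by rw [hw4]; simp
    rw [← this]
    simp
    ring

theorem continuous_pairing (y : Fin n → ℤˣ) : Continuous fun l : Edge n → ℝ => pairing l y := by
  unfold pairing
  fun_prop

theorem continuous_charFn : Continuous (charFn (n := n)) := by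
  unfold charFn
  have := continuous_pairing (n := n)
  fun_prop

theorem isCompact_cube (R : ℝ) : IsCompact (cube n R) :=
  isCompact_univ_pi fun _ => isCompact_Icc

theorem sum_integral_cube_exp (z : Edge n → ℤ) :
    ∑ m : Edge n → Fin 4, ∫ u in cube n (Real.pi / 4),
      Complex.exp (-((∑ e, (quarterShift m e + u e) * z e : ℝ) * Complex.I)) =
      if z = 0 then (2 * (Real.pi : ℂ)) ^ n.choose 2 else 0 := by
  have h : ∀ m : Edge n → Fin 4, ∫ u in cube n (Real.pi / 4),
      Complex.exp (-((∑ e, (quarterShift m e + u e) * z e : ℝ) * Complex.I)) =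
      ∏ e, ∫ u in Set.Icc (-(Real.pi / 4)) (Real.pi / 4),
        Complex.exp (-(((Real.pi / 2 * (m e : ℕ) + u : ℝ) : ℂ) * z e * Complex.I)) := by
    intro m
    unfold cube
    rw [volume_pi, Measure.restrict_pi_pi, ← integral_fintype_prod_eq_prod]
    congr 1; ext u
    rw [← Complex.exp_sum]
    push_cast
    rw [Finset.sum_mul, ← Finset.sum_neg_distrib]
    simp only [quarterShift]
    push_cast
    rfl
  simp only [h]
  rw [← Fintype.prod_sum fun e j => ∫ u in Set.Icc (-(Real.pi / 4)) (Real.pi / 4),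
        Complex.exp (-(((Real.pi / 2 * ((j : Fin 4) : ℕ) + u : ℝ) : ℂ) * z e * Complex.I))]
  simp only [sum_integral_quarter]
  split_ifs with hz
  · subst hz
    simp [Finset.prod_const, card_edge]
  · obtain ⟨e, he⟩ := Function.ne_iff.1 hz
    exact Finset.prod_eq_zero (Finset.mem_univ e) (if_neg he)

/-- Fourier inversion for the law of the walk, the torus being cut into `4 ^ d` cubes. -/
theorem P_fourier (t : ℕ) (z : Edge n → ℤ) :
    (2 * (Real.pi : ℂ)) ^ n.choose 2 * (P n t 0 z : ℂ) =
      ∑ m : Edge n → Fin 4, ∫ u in cube n (Real.pi / 4), charFn (quarterShift m + u) ^ t *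
        Complex.exp (-((∑ e, (quarterShift m e + u e) * z e : ℝ) * Complex.I)) := by
  -- Averaging exp(-iλ·(z - Z y)) over y produces one more factor φ(λ).
  induction t generalizing z with
  | zero =>
    simp only [pow_zero, one_mul]
    rw [sum_integral_cube_exp, P_zero]
    split_ifs <;> simp
  | succ t ih =>
    rw [P_succ]
    push_cast
    rw [mul_div_assoc', Finset.mul_sum]
    simp only [ih]
    rw [Finset.sum_comm, Finset.sum_div]
    refine Finset.sum_congr rfl fun m _ => ?_
    have hc := continuous_charFn (n := n)
    rw [← integral_finsetSum, ← integral_div]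
    · congr 1; ext u
      rw [← Finset.mul_sum, pow_succ, mul_div_assoc, mul_assoc]
      congr 1
      unfold charFn
      rw [div_mul_eq_mul_div, Finset.sum_mul]
      congr 1
      refine Finset.sum_congr rfl fun y _ => ?_
      rw [← Complex.exp_add]
      congr 1
      unfold pairing
      rw [← neg_mul, ← neg_mul, ← add_mul]
      congr 1
      push_cast
      rw [← Finset.sum_neg_distrib, ← Finset.sum_neg_distrib, ← Finset.sum_add_distrib]
      refine Finset.sum_congr rfl fun e _ => ?_
      simp only [Pi.add_apply, Pi.sub_apply]
      push_cast
      ring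
    · intro y _
      exact (Continuous.continuousOn (by fun_prop)).integrableOn_compact (isCompact_cube _)

end

/-! ### Shifted cubes, sign characters and decay away from the origin -/

section

open MeasureTheory

variable {n : ℕ}

/-- The sign character `y ↦ ∏ (yᵢ yⱼ) ^ mᵢⱼ`. -/
def edgeChar (m : Edge n → Fin 4) : (Fin n → ℤˣ) →* ℤˣ where
  toFun y := ∏ e, (y e.1.1 * y e.1.2) ^ (m e : ℕ)
  map_one' := by simp
  map_mul' y w := by
    rw [← Finset.prod_mul_distrib]
    refine Finset.prod_congr rfl fun e _ => ?_
    rw [← mul_pow, Pi.mul_apply, Pi.mul_apply, mul_mul_mul_comm]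

/-- The mean of `exp (i l · Z y)` twisted by a sign character. -/
noncomputable def twistedMean (χ : (Fin n → ℤˣ) →* ℤˣ) (l : Edge n → ℝ) : ℂ :=
  (∑ y, ((χ y : ℤ) : ℂ) * Complex.exp (pairing l y * Complex.I)) / 2 ^ n

theorem twistedMean_one (l : Edge n → ℝ) : twistedMean 1 l = charFn l := by
  simp [twistedMean, charFn]

theorem exp_half_pi_mul_unit (s : ℤˣ) :
    Complex.exp ((Real.pi / 2 : ℝ) * ((s : ℤ) : ℂ) * Complex.I) = Complex.I * ((s : ℤ) : ℂ) := by
  rcases Int.units_eq_one_or s with rfl | rfl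
  · simp [Complex.exp_pi_div_two_mul_I]
  · simp [Complex.exp_neg, Complex.exp_pi_div_two_mul_I]

/-- Each edge contributes (i yᵢyⱼ)^m: a power of i free of y, and a sign that belongs to the
character. -/
theorem charFn_quarterShift_add (m : Edge n → Fin 4) (u : Edge n → ℝ) :
    charFn (quarterShift m + u) =
      Complex.I ^ (∑ e, (m e : ℕ)) * twistedMean (edgeChar m) u := by
  unfold charFn twistedMean
  rw [mul_div_assoc', Finset.mul_sum]
  congr 1
  refine Finset.sum_congr rfl fun y _ => ?_
  have h1 : pairing (quarterShift m + u) y = pairing (quarterShift m) y + pairing u y := by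
    simp [pairing, add_mul, Finset.sum_add_distrib]
  rw [h1, Complex.ofReal_add, add_mul, Complex.exp_add, ← mul_assoc]
  congr 1
  unfold pairing
  rw [Complex.ofReal_sum, Finset.sum_mul, Complex.exp_sum, ← Finset.prod_pow_eq_pow_sum]
  simp only [edgeChar, MonoidHom.coe_mk, OneHom.coe_mk]
  push_cast
  rw [← Finset.prod_mul_distrib]
  refine Finset.prod_congr rfl fun e _ => ?_
  have h2 := exp_half_pi_mul_unit (y e.1.1 * y e.1.2)
  push_cast at h2
  rw [← mul_pow, ← h2, ← Complex.exp_nat_mul]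
  congr 1
  simp only [quarterShift, Z]
  push_cast
  ring

theorem norm_charFn_quarterShift_add (m : Edge n → Fin 4) (u : Edge n → ℝ) :
    ‖charFn (quarterShift m + u)‖ = ‖twistedMean (edgeChar m) u‖ := by
  rw [charFn_quarterShift_add, norm_mul, norm_pow, Complex.norm_I, one_pow, one_mul]

/-- The exponent 4t removes the power of i, so no phases remain. -/
theorem charFn_quarterShift_add_pow {m : Edge n → Fin 4} (hm : edgeChar m = 1)
    (u : Edge n → ℝ) (t : ℕ) : charFn (quarterShift m + u) ^ (4 * t) = charFn u ^ (4 * t) := by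
  rw [charFn_quarterShift_add, hm, twistedMean_one, mul_pow, ← pow_mul,
    show (∑ e, (m e : ℕ)) * (4 * t) = 4 * ((∑ e, (m e : ℕ)) * t) by ring, pow_mul,
    Complex.I_pow_four, one_pow, one_mul]

theorem symMat_comm (l : Edge n → ℝ) (i j : Fin n) : symMat l i j = symMat l j i := by
  unfold symMat
  rcases lt_trichotomy i j with h | h | h
  · simp [h, h.not_gt]
  · simp [h]
  · simp [h, h.not_gt]

theorem symMat_self (l : Edge n → ℝ) (i : Fin n) : symMat l i i = 0 := by simp [symMat]

/-- The sign vector with a single `-1`, at `k`. -/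
def flip (k : Fin n) : Fin n → ℤˣ := Pi.mulSingle k (-1)

theorem flip_cast (k i : Fin n) : ((flip k i : ℤ) : ℝ) = 1 - 2 * if i = k then 1 else 0 := by
  unfold flip
  by_cases h : i = k
  · subst h
    simp
    norm_num
  · simp [h]

theorem pairing_flip_mul (l : Edge n → ℝ) (k : Fin n) (y : Fin n → ℤˣ) :
    pairing l (flip k * y) =
      pairing l y - 2 * (((y k : ℤ) : ℝ) * linForm (symMat l k) y) := by
  rw [pairing_eq_quadForm, pairing_eq_quadForm]
  have h : quadForm (symMat l) y - quadForm (symMat l) (flip k * y) =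
      ∑ i, ∑ j, ((if i = k then 2 * (((y k : ℤ) : ℝ) * if k < j then
        symMat l k j * ((y j : ℤ) : ℝ) else 0) else 0) +
        if j = k then 2 * (((y k : ℤ) : ℝ) * if i < k then
        symMat l k i * ((y i : ℤ) : ℝ) else 0) else 0) := by
    unfold quadForm
    simp only [← Finset.sum_sub_distrib]
    refine Finset.sum_congr rfl fun i _ => Finset.sum_congr rfl fun j _ => ?_
    simp only [Pi.mul_apply, Units.val_mul, Int.cast_mul, flip_cast]
    by_cases hij : i < j
    · by_cases hi : i = k
      · subst hi
        simp [hij, hij.ne']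
        ring
      · by_cases hj : j = k
        · subst hj
          simp [hij, hij.ne, symMat_comm l i j]
          ring
        · simp [hij, hi, hj]
    · by_cases hi : i = k
      · subst hi
        by_cases hj : j = i <;> simp [hij, hj]
      · by_cases hj : j = k
        · subst hj
          simp [hij, hi]
        · simp [hij, hi, hj]
  have h2 : ∑ i, ∑ j, ((if i = k then 2 * (((y k : ℤ) : ℝ) * if k < j then
        symMat l k j * ((y j : ℤ) : ℝ) else 0) else 0) +
        if j = k then 2 * (((y k : ℤ) : ℝ) * if i < k then
        symMat l k i * ((y i : ℤ) : ℝ) else 0) else 0) =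
      2 * (((y k : ℤ) : ℝ) * linForm (symMat l k) y) := by
    simp only [Finset.sum_add_distrib]
    rw [Finset.sum_comm]
    simp only [Finset.sum_ite_eq', Finset.mem_univ, if_true]
    rw [← Finset.sum_add_distrib]
    unfold linForm
    rw [Finset.mul_sum, Finset.mul_sum]
    refine Finset.sum_congr rfl fun j _ => ?_
    rcases lt_trichotomy j k with h | h | h
    · simp [h, h.not_gt]
    · subst h
      simp [symMat_self]
    · simp [h, h.not_gt]
  linarith

theorem signMean_cos_linForm {n : ℕ} (a : Fin n → ℝ) :
    signMean (fun y => Real.cos (linForm a y)) = ∏ i, Real.cos (a i) := by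
  induction n with
  | zero => simp [signMean_zero_dim, linForm]
  | succ n ih =>
    rw [signMean_succ, Fin.prod_univ_succ, ← ih, ← signMean_const_mul]
    congr 1; ext y
    simp only [linForm_cons, Units.val_one, Units.val_neg, Int.cast_one, Int.cast_neg,
      Real.cos_add, mul_one, mul_neg, Real.cos_neg, Real.sin_neg]
    ring

theorem normSq_one_add_sign_mul_exp (s : ℤˣ) (v : ℝ) :
    ‖1 + ((s : ℤ) : ℂ) * Complex.exp (v * Complex.I)‖ ^ 2 =
      2 + 2 * ((s : ℤ) : ℝ) * Real.cos v := by
  rw [← Complex.normSq_eq_norm_sq, Complex.normSq_apply]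
  have := Real.sin_sq_add_cos_sq v
  rcases Int.units_eq_one_or s with rfl | rfl
  · simp [Complex.exp_ofReal_mul_I_re, Complex.exp_ofReal_mul_I_im]
    linarith
  · simp [Complex.exp_ofReal_mul_I_re, Complex.exp_ofReal_mul_I_im]
    linarith

/-- Flipping y at k multiplies the summand by χ(flip k)e^{iv}, where v is, up to sign, twice a
linear form in y. Cauchy–Schwarz on the paired sum leaves the mean of 2 + 2χ(flip k) cos v, and the
mean of the cosine factorises. -/
theorem normSq_twistedMean_le (χ : (Fin n → ℤˣ) →* ℤˣ) (l : Edge n → ℝ) (k : Fin n) :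
    ‖twistedMean χ l‖ ^ 2 ≤
      (1 + ((χ (flip k) : ℤ) : ℝ) * ∏ j, Real.cos (2 * symMat l k j)) / 2 := by
  set f : (Fin n → ℤˣ) → ℂ := fun y => ((χ y : ℤ) : ℂ) * Complex.exp (pairing l y * Complex.I)
  set v : (Fin n → ℤˣ) → ℝ := fun y => -(2 * (((y k : ℤ) : ℝ) * linForm (symMat l k) y))
  have h1 : ∑ y, f y = (∑ y, (f y + f (flip k * y))) / 2 := by
    rw [Finset.sum_add_distrib, Fintype.sum_equiv (Equiv.mulLeft (flip k)) (fun y => f (flip k * y))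
      f fun y => rfl]
    ring
  have h2 : ∀ y, ‖f y + f (flip k * y)‖ ^ 2 =
      2 + 2 * ((χ (flip k) : ℤ) : ℝ) * Real.cos (linForm (fun j => 2 * symMat l k j) y) := by
    intro y
    have e1 : f y + f (flip k * y) =
        f y * (1 + ((χ (flip k) : ℤ) : ℂ) * Complex.exp (v y * Complex.I)) := by
      simp only [f, v, pairing_flip_mul, map_mul, Units.val_mul, Int.cast_mul, sub_eq_add_neg,
        Complex.ofReal_add, add_mul, Complex.exp_add]
      ring
    have e2 : ‖f y‖ = 1 := by
      simp only [f, norm_mul, Complex.norm_exp_ofReal_mul_I, mul_one]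
      rcases Int.units_eq_one_or (χ y) with h | h <;> simp [h]
    have e3 : Real.cos (v y) = Real.cos (linForm (fun j => 2 * symMat l k j) y) := by
      have e4 : linForm (fun j => 2 * symMat l k j) y = 2 * linForm (symMat l k) y := by
        simp [linForm, Finset.mul_sum, mul_assoc]
      simp only [v, e4, Real.cos_neg]
      rcases Int.units_eq_one_or (y k) with h | h <;> simp [h]
    rw [e1, norm_mul, e2, one_mul, normSq_one_add_sign_mul_exp, e3]
  have h3 : ‖∑ y, (f y + f (flip k * y))‖ ^ 2 ≤
      2 ^ n * ∑ y, ‖f y + f (flip k * y)‖ ^ 2 := by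
    refine (pow_le_pow_left₀ (norm_nonneg _) (norm_sum_le _ _) 2).trans ?_
    refine sq_sum_le_card_mul_sum_sq.trans (le_of_eq ?_)
    simp
  have h4 : (∑ y, ‖f y + f (flip k * y)‖ ^ 2) / 2 ^ n =
      2 + 2 * ((χ (flip k) : ℤ) : ℝ) * ∏ j, Real.cos (2 * symMat l k j) := by
    rw [← signMean_cos_linForm, ← signMean_const_mul, ← signMean_const (n := n) 2, ← signMean_add]
    simp only [signMean_const, h2]
    rfl
  have h5 : ‖twistedMean χ l‖ ^ 2 = ‖∑ y, (f y + f (flip k * y))‖ ^ 2 / 2 ^ n / 2 ^ n / 4 := by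
    change ‖(∑ y, f y) / 2 ^ n‖ ^ 2 = _
    rw [h1]
    simp only [norm_div, norm_pow, Complex.norm_ofNat, div_pow]
    ring
  have hp : (0 : ℝ) < 2 ^ n := by positivity
  have h6 : ‖∑ y, (f y + f (flip k * y))‖ ^ 2 / 2 ^ n ≤ ∑ y, ‖f y + f (flip k * y)‖ ^ 2 := by
    rw [div_le_iff₀ hp]
    linarith
  rw [h5]
  have h7 := div_le_div_of_nonneg_right h6 hp.le
  rw [h4] at h7
  linarith

theorem abs_symMat_le {l : Edge n → ℝ} {R : ℝ} (hR : 0 ≤ R) (h : l ∈ cube n R) (i j : Fin n) :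
    |symMat l i j| ≤ R := by
  unfold symMat
  split_ifs with h1 h2
  · exact abs_le.2 (h _ trivial)
  · exact abs_le.2 (h _ trivial)
  · simpa

theorem cos_two_mul_symMat_nonneg {l : Edge n → ℝ} (h : l ∈ cube n (Real.pi / 4)) (i j : Fin n) :
    0 ≤ Real.cos (2 * symMat l i j) := by
  have h1 := abs_le.1 (abs_symMat_le (by positivity) h i j)
  exact Real.cos_nonneg_of_mem_Icc ⟨by linarith, by linarith⟩

/-- Single flips generate the group of sign vectors. -/
theorem exists_edgeChar_flip_eq {m : Edge n → Fin 4} (hm : edgeChar m ≠ 1) :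
    ∃ k, edgeChar m (flip k) = -1 := by
  by_contra! h
  refine hm (MonoidHom.ext fun y => ?_)
  rw [← Finset.univ_prod_mulSingle y, map_prod]
  refine Finset.prod_eq_one fun k _ => ?_
  rcases Int.units_eq_one_or (y k) with hk | hk
  · simp [hk]
  · rw [hk]
    exact (Int.units_eq_one_or _).resolve_right (h k)

theorem normSq_twistedMean_le_half {m : Edge n → Fin 4} (hm : edgeChar m ≠ 1) {l : Edge n → ℝ}
    (h : l ∈ cube n (Real.pi / 4)) : ‖twistedMean (edgeChar m) l‖ ^ 2 ≤ 1 / 2 := by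
  obtain ⟨k, hk⟩ := exists_edgeChar_flip_eq hm
  have h1 := normSq_twistedMean_le (edgeChar m) l k
  have h2 : 0 ≤ ∏ j, Real.cos (2 * symMat l k j) :=
    Finset.prod_nonneg fun j _ => cos_two_mul_symMat_nonneg h k j
  rw [hk] at h1
  push_cast at h1
  linarith

/-- Flip at an endpoint of an edge with |λ_e| > δ: all cosines lie in [0, 1] and one is at most cos
2δ. Then (1 + cos 2δ)/2 ≤ 1 - δ² + δ⁴/3, and δ² ≤ 1/4 gives 11/12. -/
theorem normSq_charFn_le_of_notMem_cube {δ : ℝ} (h0 : 0 ≤ δ) (h1 : δ ≤ 1 / 2) {l : Edge n → ℝ}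
    (h : l ∈ cube n (Real.pi / 4)) (h' : l ∉ cube n δ) :
    ‖charFn l‖ ^ 2 ≤ 1 - 11 / 12 * δ ^ 2 := by
  obtain ⟨e, he⟩ : ∃ e, δ < |l e| := by
    by_contra! hc
    exact h' fun e _ => abs_le.1 (hc e)
  have h2 := normSq_twistedMean_le 1 l e.1.1
  rw [twistedMean_one] at h2
  have hle : |l e| ≤ Real.pi / 4 := abs_le.2 (h e trivial)
  have h3 : ∏ j, Real.cos (2 * symMat l e.1.1 j) ≤ Real.cos (2 * δ) := by
    rw [← Finset.mul_prod_erase _ _ (Finset.mem_univ e.1.2), symMat_edge]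
    have a1 : ∏ j ∈ Finset.univ.erase e.1.2, Real.cos (2 * symMat l e.1.1 j) ≤ 1 :=
      Finset.prod_le_one (fun j _ => cos_two_mul_symMat_nonneg h _ j) fun j _ => Real.cos_le_one _
    have a2 := cos_two_mul_symMat_nonneg h e.1.1 e.1.2
    rw [symMat_edge] at a2
    refine (mul_le_of_le_one_right a2 a1).trans ?_
    rw [← Real.cos_abs, abs_mul, abs_two]
    exact Real.cos_le_cos_of_nonneg_of_le_pi (by linarith) (by linarith [Real.pi_pos]) (by linarith)
  have h4 := cos_le_quartic (2 * δ)
  have h5 : δ ^ 2 ≤ 1 / 4 := by nlinarith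
  simp only [MonoidHom.one_apply, Units.val_one, Int.cast_one, one_mul] at h2
  nlinarith [sq_nonneg δ]

theorem pow_le_exp_of_sq_le {a δ : ℝ} (h : a ^ 2 ≤ 1 - 11 / 12 * δ ^ 2) (t : ℕ) :
    a ^ (4 * t) ≤ Real.exp (-(11 / 6 * (t : ℝ) * δ ^ 2)) := by
  have h1 : a ^ 2 ≤ Real.exp (-(11 / 12 * δ ^ 2)) :=
    h.trans (by linarith [Real.add_one_le_exp (-(11 / 12 * δ ^ 2))])
  rw [show 4 * t = 2 * (2 * t) by ring, pow_mul]
  refine (pow_le_pow_left₀ (sq_nonneg a) h1 _).trans (le_of_eq ?_)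
  rw [← Real.exp_nat_mul]
  congr 1
  push_cast
  ring

theorem eq_one_or_neg_one_of_Z (hn : 0 < n) {y : Fin n → ℤˣ}
    (h : ∀ e : Edge n, y e.1.1 * y e.1.2 = 1) : y = 1 ∨ y = -1 := by
  have h1 : ∀ j, y j = y ⟨0, hn⟩ := by
    intro j
    rcases (Fin.mk_le_of_le_val (Nat.zero_le _) : (⟨0, hn⟩ : Fin n) ≤ j).eq_or_lt with h0 | h0
    · rw [← h0]
    · have := h ⟨(⟨0, hn⟩, j), h0⟩
      rw [← mul_one (y ⟨0, hn⟩), ← Int.units_mul_self (y j), ← mul_assoc, this, one_mul]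
  rcases Int.units_eq_one_or (y ⟨0, hn⟩) with h0 | h0
  · exact Or.inl (funext fun j => by rw [h1 j, h0]; rfl)
  · exact Or.inr (funext fun j => by rw [h1 j, h0]; rfl)

-- Double counting of the sum of χ_m(y) over m and y. For fixed m it is 2ⁿ or 0; for fixed y it
-- factors over edges and vanishes unless all yᵢyⱼ = 1, that is, y = ±1.
open Classical in
theorem card_edgeChar_eq_one (hn : 0 < n) :
    (Finset.univ.filter fun m : Edge n → Fin 4 => edgeChar m = 1).card * 2 ^ n =
      2 * 4 ^ n.choose 2 := by
  have h1 : ∀ m : Edge n → Fin 4, ∑ y, ((edgeChar m y : ℤˣ) : ℤ) =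
      if edgeChar m = 1 then 2 ^ n else 0 := by
    intro m
    have := sum_hom_units ((Units.coeHom ℤ).comp (edgeChar m))
    simp only [MonoidHom.comp_apply, Units.coeHom_apply] at this
    rw [this]
    have e : (Units.coeHom ℤ).comp (edgeChar m) = 1 ↔ edgeChar m = 1 := by
      rw [MonoidHom.ext_iff, MonoidHom.ext_iff]
      simp
    simp [e]
  have h2 : ∑ m : Edge n → Fin 4, ∑ y, ((edgeChar m y : ℤˣ) : ℤ) =
      ∑ y : Fin n → ℤˣ, if y = 1 ∨ y = -1 then 4 ^ n.choose 2 else 0 := by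
    rw [Finset.sum_comm]
    refine Finset.sum_congr rfl fun y _ => ?_
    have e1 : ∑ m : Edge n → Fin 4, ((edgeChar m y : ℤˣ) : ℤ) =
        ∏ e : Edge n, ∑ j : Fin 4, (((y e.1.1 * y e.1.2 : ℤˣ) : ℤ)) ^ (j : ℕ) := by
      rw [Fintype.prod_sum]
      refine Finset.sum_congr rfl fun m _ => ?_
      simp [edgeChar]
    rw [e1]
    split_ifs with hy
    · have : ∀ e : Edge n, y e.1.1 * y e.1.2 = 1 := by
        rcases hy with rfl | rfl <;> simp
      simp [this, card_edge]
    · have : ∃ e : Edge n, y e.1.1 * y e.1.2 ≠ 1 := by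
        by_contra! hc
        exact hy (eq_one_or_neg_one_of_Z hn hc)
      obtain ⟨e, he⟩ := this
      refine Finset.prod_eq_zero (Finset.mem_univ e) ?_
      rw [(Int.units_eq_one_or _).resolve_left he]
      simp [Fin.sum_univ_four]
  have h3 : (1 : Fin n → ℤˣ) ≠ -1 := fun h => by
    have := congrFun h ⟨0, hn⟩
    simp at this
  simp only [h1] at h2
  rw [← Finset.sum_filter, ← Finset.sum_filter, Finset.sum_const, Finset.sum_const,
    Finset.filter_or, Finset.filter_eq', Finset.filter_eq', if_pos (Finset.mem_univ _),
    if_pos (Finset.mem_univ _), ← Finset.insert_eq, Finset.card_pair h3] at h2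
  simp only [nsmul_eq_mul] at h2
  exact_mod_cast h2

end

/-! ### Main term and error term -/

section

open MeasureTheory

variable {n : ℕ}

theorem cube_subset_cube {r R : ℝ} (h : r ≤ R) : cube n r ⊆ cube n R := fun _ hl e he =>
  ⟨by linarith [(hl e he).1], (hl e he).2.trans h⟩

theorem measurableSet_cube (R : ℝ) : MeasurableSet (cube n R) :=
  (isCompact_cube R).isClosed.measurableSet

theorem volume_real_cube {R : ℝ} (hR : 0 ≤ R) :
    (volume : Measure (Edge n → ℝ)).real (cube n R) = (2 * R) ^ n.choose 2 := by
  unfold cube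
  rw [Measure.real, volume_pi, Measure.pi_pi]
  simp only [Real.volume_Icc, Finset.prod_const, Finset.card_univ, card_edge, ENNReal.toReal_pow,
    sub_neg_eq_add, ← two_mul]
  rw [ENNReal.toReal_ofReal (by linarith)]

open Classical in
theorem norm_integral_sub_le {δ : ℝ} (h0 : 0 ≤ δ) (h1 : δ ≤ 1 / 2) (t : ℕ)
    (m : Edge n → Fin 4) :
    ‖(∫ u in cube n (Real.pi / 4), charFn (quarterShift m + u) ^ (4 * t)) -
      (if edgeChar m = 1 then ∫ u in cube n δ, charFn u ^ (4 * t) else 0)‖ ≤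
      Real.exp (-(11 / 6 * (t : ℝ) * δ ^ 2)) * (Real.pi / 2) ^ n.choose 2 := by
  have hpi := Real.pi_gt_three
  have hsub : cube n δ ⊆ cube n (Real.pi / 4) := cube_subset_cube (by linarith)
  have hvol : (volume : Measure (Edge n → ℝ)).real (cube n (Real.pi / 4)) =
      (Real.pi / 2) ^ n.choose 2 := by
    rw [volume_real_cube (by linarith)]
    congr 1
    ring
  have hfin : volume (cube n (Real.pi / 4)) < ⊤ := (isCompact_cube _).measure_lt_top
  split_ifs with hm
  · simp only [charFn_quarterShift_add_pow hm]
    have hint : IntegrableOn (fun u : Edge n → ℝ => charFn u ^ (4 * t)) (cube n (Real.pi / 4)) :=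
      (continuous_charFn.pow _).continuousOn.integrableOn_compact (isCompact_cube _)
    rw [← setIntegral_sdiff (measurableSet_cube δ) hint hsub]
    refine (norm_setIntegral_le_of_norm_le_const
      (lt_of_le_of_lt (measure_mono Set.sdiff_subset) hfin) (C :=
      Real.exp (-(11 / 6 * (t : ℝ) * δ ^ 2))) fun u hu => ?_).trans ?_
    · rw [norm_pow]
      exact pow_le_exp_of_sq_le (normSq_charFn_le_of_notMem_cube h0 h1 hu.1 hu.2) t
    · rw [← hvol]
      gcongr
      · exact hfin.ne
      · exact Set.sdiff_subset
  · rw [sub_zero, ← hvol]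
    refine norm_setIntegral_le_of_norm_le_const hfin fun u hu => ?_
    rw [norm_pow, norm_charFn_quarterShift_add]
    refine pow_le_exp_of_sq_le ((normSq_twistedMean_le_half hm hu).trans ?_) t
    nlinarith

/-- The 4^d cubes have total volume (2π)^d, which cancels the normalisation of the Fourier integral
and leaves a single exponential. -/
theorem abs_P_sub_le (hn : 0 < n) {δ : ℝ} (h0 : 0 ≤ δ) (h1 : δ ≤ 1 / 2) (t : ℕ) :
    |P n (4 * t) 0 0 - (2 : ℝ) ^ (2 * (n.choose 2 : ℤ) - (n : ℤ) + 1) *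
      ((∫ u in cube n δ, charFn u ^ (4 * t)).re / (2 * Real.pi) ^ n.choose 2)| ≤
      Real.exp (-(11 / 6 * (t : ℝ) * δ ^ 2)) := by
  classical
  have hpi := Real.pi_pos
  set ε := Real.exp (-(11 / 6 * (t : ℝ) * δ ^ 2))
  set J := ∫ u in cube n δ, charFn u ^ (4 * t)
  set N := (Finset.univ.filter fun m : Edge n → Fin 4 => edgeChar m = 1).card
  have hN : (2 : ℝ) ^ (2 * (n.choose 2 : ℤ) - (n : ℤ) + 1) = N := by
    have h2 : (N : ℝ) * 2 ^ n = 2 * 4 ^ n.choose 2 := by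
      exact_mod_cast card_edgeChar_eq_one hn
    rw [zpow_add₀ two_ne_zero, zpow_sub₀ two_ne_zero, zpow_mul, zpow_natCast, zpow_natCast, zpow_one]
    rw [div_mul_eq_mul_div, div_eq_iff (by positivity), h2]
    norm_num
    ring
  have hf := P_fourier (n := n) (4 * t) 0
  simp only [Pi.zero_apply, Int.cast_zero, mul_zero, Finset.sum_const_zero, Complex.ofReal_zero,
    zero_mul, neg_zero, Complex.exp_zero, mul_one] at hf
  have hs : (N : ℂ) * J = ∑ m : Edge n → Fin 4, if edgeChar m = 1 then J else 0 := by
    rw [← Finset.sum_filter, Finset.sum_const, nsmul_eq_mul]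
  have hb : ‖(2 * (Real.pi : ℂ)) ^ n.choose 2 * (P n (4 * t) 0 0 : ℂ) - N * J‖ ≤
      (2 * Real.pi) ^ n.choose 2 * ε := by
    rw [hf, hs, ← Finset.sum_sub_distrib]
    refine (norm_sum_le_of_le _ fun m _ => norm_integral_sub_le h0 h1 t m).trans (le_of_eq ?_)
    rw [Finset.sum_const, Finset.card_univ, Fintype.card_fun, Fintype.card_fin, card_edge,
      nsmul_eq_mul, show 2 * Real.pi = 4 * (Real.pi / 2) by ring, mul_pow]
    push_cast
    ring
  have hre := (Complex.abs_re_le_norm _).trans hb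
  have he : ((2 * (Real.pi : ℂ)) ^ n.choose 2 * (P n (4 * t) 0 0 : ℂ) - N * J).re =
      (2 * Real.pi) ^ n.choose 2 * (P n (4 * t) 0 0 - N * (J.re / (2 * Real.pi) ^ n.choose 2)) := by
    rw [← Complex.ofReal_natCast, ← Complex.ofReal_ofNat, ← Complex.ofReal_mul,
      ← Complex.ofReal_pow, ← Complex.ofReal_mul, Complex.sub_re, Complex.ofReal_re,
      Complex.re_ofReal_mul]
    field_simp
  rw [he, abs_mul, abs_of_pos (by positivity)] at hre
  rw [hN]
  exact le_of_mul_le_mul_left hre (by positivity)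

/-- Only squares of the one-dimensional integrals are controlled, and d may be odd; hence real
exponents d/2. -/
theorem pow_eq_sq_rpow {a : ℝ} (ha : 0 ≤ a) (d : ℕ) : a ^ d = (a ^ 2) ^ ((d : ℝ) / 2) := by
  rw [← Real.rpow_natCast, ← Real.rpow_natCast, ← Real.rpow_mul ha]
  congr 1
  push_cast
  ring

theorem gaussian_prefactor {t : ℝ} (ht : 0 < t) (d : ℕ) :
    (2 * Real.pi / (4 * t)) ^ ((d : ℝ) / 2) / (2 * Real.pi) ^ d =
      (8 * Real.pi * t) ^ (-((d : ℝ) / 2)) := by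
  have hpi := Real.pi_pos
  rw [pow_eq_sq_rpow (by positivity) d, ← Real.div_rpow (by positivity) (by positivity),
    Real.rpow_neg (by positivity), ← Real.inv_rpow (by positivity)]
  congr 1
  field_simp
  ring

theorem re_integral_le {δ : ℝ} (h0 : 0 < δ) (hx : n * δ < 1) {T : ℕ} (hT : 0 < T) :
    (∫ u in cube n δ, charFn u ^ T).re ≤ (2 * Real.pi / T) ^ ((n.choose 2 : ℝ) / 2) * U n T δ := by
  have hpi := Real.pi_pos
  have hTr : (0 : ℝ) < T := by exact_mod_cast hT
  set x : ℝ := n * δ with hxdef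
  have hx0 : 0 ≤ x := by positivity
  set c : ℝ := x ^ 2 / 2 + 3 / 8 * x ^ 4 with hc
  have hc1 : c < 1 := by
    have : x ^ 2 ≤ 1 := pow_le_one₀ hx0 hx.le
    have : x ^ 4 ≤ 1 := pow_le_one₀ hx0 hx.le
    linarith
  have hc0 : 0 ≤ c := by positivity
  set d := n.choose 2 with hd
  set s : ℝ := T * δ ^ 2 with hs
  have hs0 : 0 ≤ s := by positivity
  set b : ℝ := T / 2 * (1 - c) with hb
  have hbpos : 0 < b := mul_pos (by positivity) (by linarith)
  have hes : 0 ≤ 1 - Real.exp (-s) := by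
    have := Real.exp_le_one_iff.2 (neg_nonpos.2 hs0)
    linarith
  have step1 : (∫ u in cube n δ, charFn u ^ T).re ≤
      ∫ u in cube n δ, Real.exp (-b * ∑ e, u e ^ 2) := by
    refine (Complex.re_le_norm _).trans ((norm_integral_le_integral_norm _).trans ?_)
    refine setIntegral_mono_on ?_ ?_ (measurableSet_cube δ) fun u hu => ?_
    · exact (continuous_charFn.pow T).norm.continuousOn.integrableOn_compact (isCompact_cube _)
    · exact (Continuous.continuousOn (by fun_prop)).integrableOn_compact (isCompact_cube _)
    · rw [norm_pow]
      exact norm_charFn_pow_le u hx.le hx0 (sum_sq_le_of_mem_cube hu) T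
  -- The sinh inequality restores the rate T/2 at the price of e^{cs/2}.
  have step2 : (∫ u in Set.Icc (-δ) δ, Real.exp (-b * u ^ 2)) ^ 2 ≤
      2 * Real.pi / T * ((1 - Real.exp (-s)) * Real.exp (c * s / 2)) := by
    refine (sq_integral_Icc_gaussian_le hbpos).trans ?_
    have := one_sub_exp_div_le (a := 1 - c) (by linarith) (by linarith) hs0
    rw [sub_sub_cancel] at this
    calc _ = 2 * Real.pi / T * ((1 - Real.exp (-((1 - c) * s))) / (1 - c)) := by
          have : 1 - c ≠ 0 := by linarith
          rw [show 2 * b * δ ^ 2 = (1 - c) * s by rw [hb, hs]; ring, hb]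
          field_simp
      _ ≤ _ := by gcongr
  -- By d ≤ n²/2 the total price is at most e^{cx²/8} per step.
  have step3 : Real.exp (c * s / 2) ^ ((d : ℝ) / 2) ≤
      (1 + 1 / 9 * x ^ 6) ^ ((T : ℝ) / 2) * (1 + 1 / 12 * x ^ 4) ^ T := by
    have h1 := pow_le_pow_left₀ (Real.exp_pos _).le (exp_budget_le hx0 hx.le) T
    rw [mul_pow (1 + 1 / 12 * x ^ 4), pow_eq_sq_rpow (Real.sqrt_nonneg _), Real.sq_sqrt (by positivity),
      mul_comm ((1 + 1 / 12 * x ^ 4) ^ T)] at h1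
    refine le_trans ?_ h1
    rw [← Real.exp_mul, ← Real.exp_nat_mul, ← hc]
    apply Real.exp_le_exp.2
    have h2 : (d : ℝ) ≤ n ^ 2 / 2 := by
      rw [hd, Nat.cast_choose_two]
      nlinarith [(Nat.cast_nonneg n : (0 : ℝ) ≤ n)]
    calc c * s / 2 * ((d : ℝ) / 2) = c * s / 4 * d := by ring
      _ ≤ c * s / 4 * (n ^ 2 / 2) := by gcongr
      _ = _ := by rw [hs, hxdef]; ring
  refine step1.trans ?_
  rw [integral_cube_gaussian, card_edge, ← hd,
    pow_eq_sq_rpow (integral_nonneg fun u => (Real.exp_pos _).le)]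
  refine (Real.rpow_le_rpow (sq_nonneg _) step2 (by positivity)).trans ?_
  rw [Real.mul_rpow (by positivity) (by positivity), Real.mul_rpow hes (Real.exp_pos _).le]
  unfold U
  rw [← hxdef, ← hd, ← hs]
  refine mul_le_mul_of_nonneg_left ?_ (by positivity)
  rw [mul_comm]
  exact mul_le_mul_of_nonneg_right step3 (Real.rpow_nonneg hes _)

theorem le_re_integral {δ : ℝ} (h0 : 0 < δ) (hx : n * δ < 1) {T : ℕ} (hT : 0 < T)
    (hTx : (T : ℝ) * (n * δ) ^ 3 ≤ 1) :
    (2 * Real.pi / T) ^ ((n.choose 2 : ℝ) / 2) * L n T δ ≤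
      (∫ u in cube n δ, charFn u ^ T).re := by
  have hpi := Real.pi_pos
  have hTr : (0 : ℝ) < T := by exact_mod_cast hT
  set x : ℝ := n * δ with hxdef
  have hx0 : 0 ≤ x := by positivity
  have hx4 : x ^ 4 ≤ 1 := pow_le_one₀ hx0 hx.le
  set d := n.choose 2 with hd
  set K : ℝ := (1 + 4 / 9 * (T * x ^ 3) ^ 2) ^ (-(1 / 2) : ℝ) * (1 - 1 / 12 * x ^ 4) ^ T with hK
  have hK0 : 0 ≤ K := by
    have : 0 ≤ 1 - 1 / 12 * x ^ 4 := by linarith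
    positivity
  have hcont := (continuous_charFn (n := n)).pow T
  have step1 : K * ∫ u in cube n δ, Real.exp (-(T / 2 : ℝ) * ∑ e, u e ^ 2) ≤
      (∫ u in cube n δ, charFn u ^ T).re := by
    have hre : (∫ u in cube n δ, charFn u ^ T).re = ∫ u in cube n δ, (charFn u ^ T).re :=
      (integral_re (hcont.continuousOn.integrableOn_compact (isCompact_cube δ))).symm
    rw [hre, ← integral_const_mul]
    refine setIntegral_mono_on ?_ ?_ (measurableSet_cube δ) fun u hu => ?_
    · exact (Continuous.continuousOn (by fun_prop)).integrableOn_compact (isCompact_cube _)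
    · exact (Complex.continuous_re.comp hcont).continuousOn.integrableOn_compact (isCompact_cube _)
    · exact re_charFn_pow_ge u hx.le hx0 (sum_sq_le_of_mem_cube hu) T hTx
  have hes : 0 ≤ 1 - Real.exp (-(1 / 2 * (T : ℝ) * δ ^ 2)) := by
    have := Real.exp_le_one_iff.2 (neg_nonpos.2 (by positivity : 0 ≤ 1 / 2 * (T : ℝ) * δ ^ 2))
    linarith
  refine le_trans ?_ step1
  have step2 := le_sq_integral_Icc_gaussian (b := T / 2) (by positivity) h0.le
  rw [integral_cube_gaussian, card_edge, ← hd,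
    pow_eq_sq_rpow (integral_nonneg fun u => (Real.exp_pos _).le)]
  have e : Real.pi / (T / 2) = 2 * Real.pi / T := by field_simp
  rw [e, show (T : ℝ) / 2 * δ ^ 2 = 1 / 2 * T * δ ^ 2 by ring] at step2
  have step3 := Real.rpow_le_rpow (mul_nonneg (by positivity) hes) step2
    (by positivity : 0 ≤ (d : ℝ) / 2)
  rw [Real.mul_rpow (by positivity) hes] at step3
  refine le_trans (le_of_eq ?_) (mul_le_mul_of_nonneg_left step3 hK0)
  unfold L
  rw [← hxdef, ← hd, hK,
    show 4 / 9 * ((T : ℝ) * x ^ 3) ^ 2 = 4 / 9 * (T : ℝ) ^ 2 * x ^ 6 by ring]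
  ring

end

end PartialHadamard

theorem theorem4p1 (n t : ℕ) (δ : ℝ) (hn : 2 ≤ n) (ht : 0 < t)
    (hδ : (n : ℝ) * δ ∈ Set.Ioo (0 : ℝ) 1) :
    PartialHadamard.P n (4 * t) 0 0 ≤
        (2 : ℝ) ^ (2 * (n.choose 2 : ℤ) - (n : ℤ) + 1) *
          (8 * Real.pi * (t : ℝ)) ^ (-((n.choose 2 : ℝ) / 2)) *
          PartialHadamard.U n (4 * t) δ +
        Real.exp (-(11 / 6 * (t : ℝ) * δ ^ 2)) ∧
      (4 * (t : ℝ) * ((n : ℝ) * δ) ^ 3 < 1 →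
        (2 : ℝ) ^ (2 * (n.choose 2 : ℤ) - (n : ℤ) + 1) *
            (8 * Real.pi * (t : ℝ)) ^ (-((n.choose 2 : ℝ) / 2)) *
            PartialHadamard.L n (4 * t) δ -
          Real.exp (-(11 / 6 * (t : ℝ) * δ ^ 2)) ≤
        PartialHadamard.P n (4 * t) 0 0) := by
  have hn2 : (2 : ℝ) ≤ n := by exact_mod_cast hn
  have h0 : 0 < δ := pos_of_mul_pos_right hδ.1 (by positivity)
  -- n ≥ 2 enters here; the decay estimates need δ ≤ 1/2.
  have h1 : δ ≤ 1 / 2 := by nlinarith [hδ.2]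
  have hpi := Real.pi_pos
  have key := abs_le.1 (PartialHadamard.abs_P_sub_le (by omega : 0 < n) h0.le h1 t)
  have hpre := PartialHadamard.gaussian_prefactor (t := t) (by exact_mod_cast ht) (n.choose 2)
  have hT : 0 < 4 * t := by omega
  have hcast : ((4 * t : ℕ) : ℝ) = 4 * (t : ℝ) := by push_cast; rfl
  rw [← hpre]
  have hmono : ∀ {a b c : ℝ}, a ≤ c * b →
      (2 : ℝ) ^ (2 * (n.choose 2 : ℤ) - (n : ℤ) + 1) * (a / (2 * Real.pi) ^ n.choose 2) ≤
      (2 : ℝ) ^ (2 * (n.choose 2 : ℤ) - (n : ℤ) + 1) * (c / (2 * Real.pi) ^ n.choose 2) * b := by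
    intro a b c h
    rw [mul_assoc, div_mul_eq_mul_div]
    gcongr
  have hmono' : ∀ {a b c : ℝ}, c * b ≤ a →
      (2 : ℝ) ^ (2 * (n.choose 2 : ℤ) - (n : ℤ) + 1) * (c / (2 * Real.pi) ^ n.choose 2) * b ≤
      (2 : ℝ) ^ (2 * (n.choose 2 : ℤ) - (n : ℤ) + 1) * (a / (2 * Real.pi) ^ n.choose 2) := by
    intro a b c h
    rw [mul_assoc, div_mul_eq_mul_div]
    gcongr
  constructor
  · have h := PartialHadamard.re_integral_le h0 hδ.2 hT
    rw [hcast] at h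
    linarith [key.2, hmono h]
  · intro hTx
    have h := PartialHadamard.le_re_integral h0 hδ.2 hT (by rw [hcast]; exact hTx.le)
    rw [hcast] at h
    linarith [key.1, hmono' h]
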